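/- Let $H^{1,2}(\mathbb{R}^2)$ be the completion of the space of complex-valued functions in $C_0^\infty(\mathbb{R}^2)$ under the norm $\|u\|_2+\|\partial_x u\|_2+\|\partial_{yy}u\|_2$; its elements are functions $u\in L^2(\mathbb{R}^2)$ with weak derivatives $\partial_x u,\partial_{yy}u\in L^2(\mathbb{R}^2)$. Let $p>2$ be real. Then $H^{1,2}(\mathbb{R}^2)\subset L^p(\mathbb{R}^2)$, and there exists a constant $C_{opt}>0$ such that, for every $u\in H^{1,2}(\mathbb{R}^2)$, $$ \|u\|_p^p \le C_{opt}\,\|\partial_x u\|_2^{\frac{p-2}{2}}\,\|\partial_{yy}u\|_2^{\frac{p-2}{4}}\,\|u\|_2^{\frac{p+6}{4}}, $$ where $C_{opt}$ is optimal, that is, the smallest real constant for which the inequality holds for all $u\in H^{1,2}(\mathbb{R}^2)$, and equality is attained by some $u\in H^{1,2}(\mathbb{R}^2)\setminus\{0\}$. Moreover, consider the equation $$ -\partial_{xx}W+\partial_{yyyy}W+W=|W|^{p-2}W\quad\text{in }\mathbb{R}^2, \qquad (*) $$ understood in the weak sense for $W\in H^{1,2}(\mathbb{R}^2)$. A ground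 state of $(*)$ is a nontrivial solution in $H^{1,2}(\mathbb{R}^2)$ which minimizes $$ J(u)=\tfrac12\|\partial_x u\|_2^2+\tfrac12\|\partial_{yy}u\|_2^2+\tfrac12\|u\|_2^2-\tfrac1p\|u\|_p^p $$ among all nontrivial solutions of $(*)$ in $H^{1,2}(\mathbb{R}^2)$. Then ground states of $(*)$ exist, and every ground state $W$ of $(*)$ satisfies $$ C_{opt}=\frac{p\,(p+6)^{\frac{3(p-2)}{8}-1}}{2^{\frac{p-2}{4}-2}\,(p-2)^{\frac{3(p-2)}{8}}\,\|W\|_2^{p-2}}. $$ -/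

import Mathlib

open MeasureTheory
open scoped ContDiff

/-- The plane `ℝ²`, with points `z = (x, y)` and Lebesgue measure. -/
abbrev Plane : Type := ℝ × ℝ

/-- The complex Hilbert space `L²(ℝ²)`. -/
abbrev L2 : Type := Lp ℂ 2 (volume : Measure Plane)

/-- `φ ∈ C₀^∞(ℝ²)`, complex valued. -/
def IsTest (φ : Plane → ℂ) : Prop :=
  ContDiff ℝ ∞ φ ∧ HasCompactSupport φ

/-- The classical partial derivative `∂ₓ φ`. -/
noncomputable def dX (φ : Plane → ℂ) (z : Plane) : ℂ := fderiv ℝ φ z (1, 0)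

/-- The classical partial derivative `∂_y φ`. -/
noncomputable def dY (φ : Plane → ℂ) (z : Plane) : ℂ := fderiv ℝ φ z (0, 1)

theorem IsTest.add {φ ψ : Plane → ℂ} (hφ : IsTest φ) (hψ : IsTest ψ) : IsTest (φ + ψ) :=
  ⟨hφ.1.add hψ.1, hφ.2.add hψ.2⟩

theorem IsTest.const_smul {φ : Plane → ℂ} (c : ℂ) (hφ : IsTest φ) : IsTest (c • φ) :=
  ⟨hφ.1.const_smul c, hφ.2.smul_left (f := fun _ => c)⟩

theorem IsTest.zero : IsTest (0 : Plane → ℂ) :=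
  ⟨contDiff_const, HasCompactSupport.zero⟩

theorem IsTest.differentiable {φ : Plane → ℂ} (hφ : IsTest φ) : Differentiable ℝ φ :=
  hφ.1.differentiable (by simp)

theorem IsTest.fderiv_apply {φ : Plane → ℂ} (hφ : IsTest φ) (v : Plane) :
    IsTest (fun z => fderiv ℝ φ z v) :=
  ⟨(hφ.1.fderiv_right (m := ∞) (by simp)).clm_apply contDiff_const,
    hφ.2.fderiv_apply (𝕜 := ℝ) v⟩

theorem IsTest.dX {φ : Plane → ℂ} (hφ : IsTest φ) : IsTest (dX φ) := hφ.fderiv_apply _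

theorem IsTest.dY {φ : Plane → ℂ} (hφ : IsTest φ) : IsTest (dY φ) := hφ.fderiv_apply _

theorem dX_add {φ ψ : Plane → ℂ} (hφ : IsTest φ) (hψ : IsTest ψ) :
    dX (φ + ψ) = dX φ + dX ψ := by
  funext z
  simp [dX, fderiv_add (hφ.differentiable z) (hψ.differentiable z)]

theorem dY_add {φ ψ : Plane → ℂ} (hφ : IsTest φ) (hψ : IsTest ψ) :
    dY (φ + ψ) = dY φ + dY ψ := by
  funext z
  simp [dY, fderiv_add (hφ.differentiable z) (hψ.differentiable z)]

theorem dX_smul {φ : Plane → ℂ} (c : ℂ) (hφ : IsTest φ) : dX (c • φ) = c • dX φ := by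
  funext z
  simp [dX, fderiv_const_smul (hφ.differentiable z)]

theorem dY_smul {φ : Plane → ℂ} (c : ℂ) (hφ : IsTest φ) : dY (c • φ) = c • dY φ := by
  funext z
  simp [dY, fderiv_const_smul (hφ.differentiable z)]

theorem IsTest.memLp {φ : Plane → ℂ} (hφ : IsTest φ) (q : ENNReal) : MemLp φ q volume :=
  hφ.1.continuous.memLp_of_hasCompactSupport hφ.2

/-- The copy `{(φ, ∂ₓφ, ∂_{yy}φ) : φ ∈ C₀^∞(ℝ²)}` of the space of test functions inside
`L² × L² × L²`. The norm that it inherits is equivalent to the anisotropic norm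
`‖φ‖₂ + ‖∂ₓφ‖₂ + ‖∂_{yy}φ‖₂`. -/
noncomputable def testGraph : Submodule ℂ (L2 × L2 × L2) where
  carrier := {T | ∃ φ : Plane → ℂ, IsTest φ ∧ (T.1 : Plane → ℂ) =ᵐ[volume] φ ∧
    (T.2.1 : Plane → ℂ) =ᵐ[volume] dX φ ∧ (T.2.2 : Plane → ℂ) =ᵐ[volume] dY (dY φ)}
  add_mem' := by
    rintro S T ⟨φ, hφ, h1, h2, h3⟩ ⟨ψ, hψ, k1, k2, k3⟩
    refine ⟨φ + ψ, hφ.add hψ, ?_, ?_, ?_⟩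
    · exact (Lp.coeFn_add _ _).trans (h1.add k1)
    · rw [dX_add hφ hψ]
      exact (Lp.coeFn_add _ _).trans (h2.add k2)
    · rw [dY_add hφ hψ, dY_add hφ.dY hψ.dY]
      exact (Lp.coeFn_add _ _).trans (h3.add k3)
  zero_mem' := by
    refine ⟨0, IsTest.zero, Lp.coeFn_zero _ _ _, ?_, ?_⟩
    · have : dX (0 : Plane → ℂ) = 0 := by funext z; simp [dX]
      rw [this]
      exact Lp.coeFn_zero _ _ _
    · have : dY (0 : Plane → ℂ) = 0 := by funext z; simp [dY]
      rw [this, this]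
      exact Lp.coeFn_zero _ _ _
  smul_mem' := by
    rintro c T ⟨φ, hφ, h1, h2, h3⟩
    refine ⟨c • φ, hφ.const_smul c, ?_, ?_, ?_⟩
    · exact (Lp.coeFn_smul _ _).trans (h1.const_smul c)
    · rw [dX_smul c hφ]
      exact (Lp.coeFn_smul _ _).trans (h2.const_smul c)
    · rw [dY_smul c hφ, dY_smul c hφ.dY]
      exact (Lp.coeFn_smul _ _).trans (h3.const_smul c)

/-- The energy space `H^{1,2}(ℝ²)`: the completion of `C₀^∞(ℝ²)` under
`‖u‖₂ + ‖∂ₓu‖₂ + ‖∂_{yy}u‖₂`, realised as the closure of `testGraph` in the complete space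
`L² × L² × L²`. An element is a triple `(u, ∂ₓu, ∂_{yy}u)`; the last two entries are the weak
derivatives of the first (`H12.weak_dx`, `H12.weak_dyy`), which therefore determines the triple
(`H12.fn_injective`). -/
abbrev H12 : Type := testGraph.topologicalClosure

namespace H12

/-- The function `u ∈ L²` underlying an element of `H^{1,2}`. -/
noncomputable def fn (u : H12) : L2 := (u : L2 × L2 × L2).1

/-- The weak derivative `∂ₓ u ∈ L²`. -/
noncomputable def dx (u : H12) : L2 := (u : L2 × L2 × L2).2.1

/-- The weak derivative `∂_{yy} u ∈ L²`. -/
noncomputable def dyy (u : H12) : L2 := (u : L2 × L2 × L2).2.2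

theorem integral_mul_deriv {φ ψ : Plane → ℂ} (hφ : IsTest φ) (hψ : IsTest ψ) (v : Plane) :
    ∫ z, φ z * fderiv ℝ ψ z v = -∫ z, fderiv ℝ φ z v * ψ z := by
  have key : ∀ {f g : Plane → ℂ}, IsTest f → IsTest g →
      Integrable (fun z => f z * g z) volume := fun {f g} hf hg =>
    (hf.memLp 2).integrable_mul (hg.memLp 2)
  exact integral_mul_fderiv_eq_neg_fderiv_mul_of_integrable (key (hφ.fderiv_apply v) hψ)
    (key hφ (hψ.fderiv_apply v)) (key hφ hψ) (fun z _ => hφ.differentiable z)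
    (fun z _ => hψ.differentiable z)

/-- Pairing with a fixed test function is continuous on `L²`. -/
theorem continuous_pairing {ψ : Plane → ℂ} (hψ : IsTest ψ) :
    Continuous (fun f : L2 => ∫ z, f z * ψ z) := by
  have hm : MemLp (fun z => (starRingEnd ℂ) (ψ z)) 2 (volume : Measure Plane) :=
    (hψ.memLp 2).star
  have h : (fun f : L2 => ∫ z, f z * ψ z) = fun f : L2 => inner ℂ hm.toLp f := by
    funext f
    rw [L2.inner_def]
    refine integral_congr_ae ?_
    filter_upwards [hm.coeFn_toLp] with z hz
    simp [hz]
  rw [h]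
  exact continuous_const.inner continuous_id

/-- `∂ₓ u` is the weak derivative of `u`. -/
theorem weak_dx (u : H12) {ψ : Plane → ℂ} (hψ : IsTest ψ) :
    ∫ z, u.fn z * dX ψ z = -∫ z, u.dx z * ψ z := by
  have hclosed : IsClosed {T : L2 × L2 × L2 | ∫ z, T.1 z * dX ψ z = -∫ z, T.2.1 z * ψ z} :=
    isClosed_eq ((continuous_pairing hψ.dX).comp continuous_fst)
      ((continuous_pairing hψ).comp (continuous_fst.comp continuous_snd)).neg
  refine closure_minimal ?_ hclosed u.2
  rintro T ⟨φ, hφ, h1, h2, -⟩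
  change ∫ z, T.1 z * dX ψ z = -∫ z, T.2.1 z * ψ z
  have e1 : ∫ z, T.1 z * dX ψ z = ∫ z, φ z * dX ψ z :=
    integral_congr_ae (h1.mul (Filter.EventuallyEq.refl _ _))
  have e2 : ∫ z, T.2.1 z * ψ z = ∫ z, dX φ z * ψ z :=
    integral_congr_ae (h2.mul (Filter.EventuallyEq.refl _ _))
  rw [e1, e2]
  exact integral_mul_deriv hφ hψ (1, 0)

/-- `∂_{yy} u` is the weak derivative of `u`. -/
theorem weak_dyy (u : H12) {ψ : Plane → ℂ} (hψ : IsTest ψ) :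
    ∫ z, u.fn z * dY (dY ψ) z = ∫ z, u.dyy z * ψ z := by
  have hclosed : IsClosed {T : L2 × L2 × L2 | ∫ z, T.1 z * dY (dY ψ) z = ∫ z, T.2.2 z * ψ z} :=
    isClosed_eq ((continuous_pairing hψ.dY.dY).comp continuous_fst)
      ((continuous_pairing hψ).comp (continuous_snd.comp continuous_snd))
  refine closure_minimal ?_ hclosed u.2
  rintro T ⟨φ, hφ, h1, -, h3⟩
  change ∫ z, T.1 z * dY (dY ψ) z = ∫ z, T.2.2 z * ψ z
  have e1 : ∫ z, T.1 z * dY (dY ψ) z = ∫ z, φ z * dY (dY ψ) z :=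
    integral_congr_ae (h1.mul (Filter.EventuallyEq.refl _ _))
  have e2 : ∫ z, T.2.2 z * ψ z = ∫ z, dY (dY φ) z * ψ z :=
    integral_congr_ae (h3.mul (Filter.EventuallyEq.refl _ _))
  rw [e1, e2]
  have s1 : ∫ z, φ z * dY (dY ψ) z = -∫ z, dY φ z * dY ψ z :=
    integral_mul_deriv hφ hψ.dY (0, 1)
  have s2 : ∫ z, dY φ z * dY ψ z = -∫ z, dY (dY φ) z * ψ z :=
    integral_mul_deriv hφ.dY hψ (0, 1)
  rw [s1, s2, neg_neg]

theorem eq_zero_of_pairing {f : L2} (h : ∀ ψ, IsTest ψ → ∫ z, f z * ψ z = 0) : f = 0 := by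
  refine (Lp.eq_zero_iff_ae_eq_zero).2 ?_
  refine ae_eq_zero_of_integral_contDiff_smul_eq_zero
    ((Lp.memLp f).locallyIntegrable (by norm_num)) ?_
  intro g hg hgc
  have ht : IsTest (fun z => (g z : ℂ)) :=
    ⟨Complex.ofRealCLM.contDiff.comp hg, hgc.comp_left (g := fun t : ℝ => (t : ℂ)) (by simp)⟩
  rw [← h _ ht]
  refine integral_congr_ae (Filter.Eventually.of_forall fun z => ?_)
  simp [mul_comm]

/-- An element of `H^{1,2}` is determined by its underlying function. -/
theorem fn_injective : Function.Injective fn := by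
  intro u v huv
  have hx : u.dx - v.dx = 0 := by
    refine eq_zero_of_pairing fun ψ hψ => ?_
    have h0 := weak_dx (u - v) hψ
    have hz : (u - v).fn = 0 := sub_eq_zero.2 huv
    rw [hz] at h0
    have h1 : ∫ z, (0 : L2) z * dX ψ z = 0 := by
      simp
    rw [h1] at h0
    exact neg_eq_zero.1 h0.symm
  have hy : u.dyy - v.dyy = 0 := by
    refine eq_zero_of_pairing fun ψ hψ => ?_
    have h0 := weak_dyy (u - v) hψ
    have hz : (u - v).fn = 0 := sub_eq_zero.2 huv
    rw [hz] at h0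
    have h1 : ∫ z, (0 : L2) z * dY (dY ψ) z = 0 := by
      simp
    rw [h1] at h0
    exact h0.symm
  exact Subtype.ext (Prod.ext huv (Prod.ext (sub_eq_zero.1 hx) (sub_eq_zero.1 hy)))

/-- `‖u‖_p^p = ∫ |u|^p dx dy`. -/
noncomputable def normPow (p : ℝ) (u : H12) : ℝ := ∫ z, ‖u.fn z‖ ^ p

/-- The right-hand side of the inequality without its constant:
`‖∂ₓu‖₂^{(p-2)/2} ‖∂_{yy}u‖₂^{(p-2)/4} ‖u‖₂^{(p+6)/4}`. -/
noncomputable def gnProduct (p : ℝ) (u : H12) : ℝ :=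
  ‖u.dx‖ ^ ((p - 2) / 2) * ‖u.dyy‖ ^ ((p - 2) / 4) * ‖u.fn‖ ^ ((p + 6) / 4)

/-- `W` is a weak solution of `-∂ₓₓ W + ∂_{yyyy} W + W = |W|^{p-2} W` in `ℝ²`. -/
def IsSolution (p : ℝ) (W : H12) : Prop :=
  ∀ φ : Plane → ℂ, IsTest φ →
    (∫ z, W.dx z * dX φ z) + (∫ z, W.dyy z * dY (dY φ) z) + (∫ z, W.fn z * φ z) =
      ∫ z, ((‖W.fn z‖ ^ (p - 2) : ℝ) : ℂ) * W.fn z * φ z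

/-- The energy functional of that equation,
`J(u) = ½‖∂ₓu‖₂² + ½‖∂_{yy}u‖₂² + ½‖u‖₂² - (1/p)‖u‖_p^p`. -/
noncomputable def action (p : ℝ) (u : H12) : ℝ :=
  1 / 2 * ‖u.dx‖ ^ 2 + 1 / 2 * ‖u.dyy‖ ^ 2 + 1 / 2 * ‖u.fn‖ ^ 2 - 1 / p * normPow p u

/-- A ground state: a nontrivial solution that minimises `J` among all nontrivial solutions. -/
def IsGroundState (p : ℝ) (W : H12) : Prop :=
  W ≠ 0 ∧ IsSolution p W ∧ ∀ V : H12, V ≠ 0 → IsSolution p V → action p W ≤ action p V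

end H12

/-! Everything rests on the bound `‖u‖_∞ ≤ 2 ‖∂ₓu‖₂^{1/2} ‖∂_{yy}u‖₂^{1/4} ‖u‖₂^{1/4}`
(`IsTest.norm_pow_eight_le`, `H12.norm_value_le`). With `‖u‖_p^p ≤ ‖u‖_∞^{p-2} ‖u‖₂²` it gives the
inequality with a non-optimal constant. It also makes point evaluation a continuous functional, so
weak convergence implies pointwise convergence.

Let `S` be the infimum of `energy` on `normPow p = 1`. Since the sup norm along a minimising
sequence stays away from zero, translations produce a nonzero weak limit. The Brezis–Lieb lemma and
the strict concavity of `t ↦ t^{2/p}` forbid splitting of mass, so `S` is attained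
(`H12.exists_minimizer`). A multiple of the minimiser solves the equation. A solution has `energy =
normPow`, so its action is a positive multiple of `normPow`, and the ground states are the solutions
for which `energy = S · normPow^{2/p}` (`H12.isGroundState_iff`).

The inequality is the scale-invariant form of `S · normPow^{2/p} ≤ energy`. Weighted AM–GM bounds
`energy` below by `geomEnergy`, a multiple of `gnProduct^{2/p}` which rescales exactly like
`normPow^{2/p}`, and every nonzero function can be rescaled to equality in AM–GM. Hence `S` also
determines the optimal constant. A ground state is an equality case of AM–GM, which fixes the ratios
of its three norms without any Pohozaev identity; the formula for the constant follows. -/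

theorem sq_integral_norm_mul_le {α : Type*} [MeasurableSpace α] {μ : Measure α} {f g : α → ℂ}
    (hf : MemLp f 2 μ) (hg : MemLp g 2 μ) :
    (∫ a, ‖f a‖ * ‖g a‖ ∂μ) ^ 2 ≤ (∫ a, ‖f a‖ ^ 2 ∂μ) * ∫ a, ‖g a‖ ^ 2 ∂μ := by
  have h := integral_mul_norm_le_Lp_mul_Lq (μ := μ) (f := f) (g := g) Real.HolderConjugate.two_two
    (by simpa using hf) (by simpa using hg)
  have h0 : 0 ≤ ∫ a, ‖f a‖ * ‖g a‖ ∂μ := integral_nonneg fun a => by positivity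
  have hf0 : 0 ≤ ∫ a, ‖f a‖ ^ 2 ∂μ := integral_nonneg fun a => by positivity
  have hg0 : 0 ≤ ∫ a, ‖g a‖ ^ 2 ∂μ := integral_nonneg fun a => by positivity
  simp only [Real.rpow_two, ← Real.sqrt_eq_rpow] at h
  calc (∫ a, ‖f a‖ * ‖g a‖ ∂μ) ^ 2 ≤ (√(∫ a, ‖f a‖ ^ 2 ∂μ) * √(∫ a, ‖g a‖ ^ 2 ∂μ)) ^ 2 := by
        gcongr
    _ = _ := by rw [mul_pow, Real.sq_sqrt hf0, Real.sq_sqrt hg0]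

/-! ### The sup bound for test functions -/

namespace IsTest

variable {φ ψ : Plane → ℂ}

theorem continuous (hφ : IsTest φ) : Continuous φ := hφ.1.continuous

theorem isClosedEmbedding_left (y : ℝ) :
    Topology.IsClosedEmbedding (fun x : ℝ => ((x, y) : Plane)) :=
  (Isometry.of_dist_eq fun a b => by simp [Prod.dist_eq]).isClosedEmbedding

theorem isClosedEmbedding_right (x : ℝ) :
    Topology.IsClosedEmbedding (fun y : ℝ => ((x, y) : Plane)) :=
  (Isometry.of_dist_eq fun a b => by simp [Prod.dist_eq]).isClosedEmbedding

theorem contDiff_left (hφ : IsTest φ) (y : ℝ) : ContDiff ℝ ∞ fun x : ℝ => φ (x, y) :=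
  hφ.1.comp (contDiff_id.prodMk contDiff_const)

theorem contDiff_right (hφ : IsTest φ) (x : ℝ) : ContDiff ℝ ∞ fun y : ℝ => φ (x, y) :=
  hφ.1.comp (contDiff_const.prodMk contDiff_id)

theorem hasCompactSupport_left (hφ : IsTest φ) (y : ℝ) :
    HasCompactSupport fun x : ℝ => φ (x, y) :=
  hφ.2.comp_isClosedEmbedding (isClosedEmbedding_left y)

theorem hasCompactSupport_right (hφ : IsTest φ) (x : ℝ) :
    HasCompactSupport fun y : ℝ => φ (x, y) :=
  hφ.2.comp_isClosedEmbedding (isClosedEmbedding_right x)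

theorem memLp_left (hφ : IsTest φ) (y : ℝ) (q : ENNReal) : MemLp (fun x : ℝ => φ (x, y)) q :=
  (hφ.contDiff_left y).continuous.memLp_of_hasCompactSupport (hφ.hasCompactSupport_left y)

theorem memLp_right (hφ : IsTest φ) (x : ℝ) (q : ENNReal) : MemLp (fun y : ℝ => φ (x, y)) q :=
  (hφ.contDiff_right x).continuous.memLp_of_hasCompactSupport (hφ.hasCompactSupport_right x)

theorem hasDerivAt_left (hφ : IsTest φ) (x y : ℝ) :
    HasDerivAt (fun t : ℝ => φ (t, y)) (_root_.dX φ (x, y)) x := by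
  have h1 : HasDerivAt (fun t : ℝ => ((t, y) : Plane)) (1, 0) x :=
    (hasDerivAt_id x).prodMk (hasDerivAt_const x y)
  exact (hφ.differentiable (x, y)).hasFDerivAt.comp_hasDerivAt x h1

theorem hasDerivAt_right (hφ : IsTest φ) (x y : ℝ) :
    HasDerivAt (fun t : ℝ => φ (x, t)) (_root_.dY φ (x, y)) y := by
  have h1 : HasDerivAt (fun t : ℝ => ((x, t) : Plane)) (0, 1) y :=
    (hasDerivAt_const y x).prodMk (hasDerivAt_id y)
  exact (hφ.differentiable (x, y)).hasFDerivAt.comp_hasDerivAt y h1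

theorem dX_dY (hφ : IsTest φ) : _root_.dX (_root_.dY φ) = _root_.dY (_root_.dX φ) := by
  funext z
  have hs : IsSymmSndFDerivAt ℝ φ z :=
    (hφ.1.contDiffAt (x := z)).isSymmSndFDerivAt (by simpa using ENat.LEInfty.out)
  have hd : DifferentiableAt ℝ (fderiv ℝ φ) z :=
    (hφ.1.fderiv_right (m := 1) (by norm_cast)).differentiable (by simp) z
  have h : ∀ v w : Plane, fderiv ℝ (fun z => fderiv ℝ φ z v) z w = fderiv ℝ (fderiv ℝ φ) z w v := by
    intro v w
    rw [fderiv_clm_apply hd (differentiableAt_const v)]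
    simp
  change fderiv ℝ (fun z => fderiv ℝ φ z (0, 1)) z (1, 0) =
    fderiv ℝ (fun z => fderiv ℝ φ z (1, 0)) z (0, 1)
  rw [h, h]
  exact hs.eq _ _

end IsTest

/-- The fundamental theorem of calculus for `‖g‖²`, `g` of compact support. -/
theorem norm_sq_eq_integral_Iic {g g' : ℝ → ℂ} (hg : ContDiff ℝ ∞ g) (hc : HasCompactSupport g)
    (hd : ∀ t, HasDerivAt g (g' t) t) (x : ℝ) :
    ‖g x‖ ^ 2 = ∫ t in Set.Iic x, 2 * inner ℝ (g t) (g' t) := by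
  have h := HasCompactSupport.integral_Iic_deriv_eq (f := fun t => ‖g t‖ ^ 2)
    ((hg.norm_sq ℝ).of_le (by simp)) (hc.comp_left (g := fun w : ℂ => ‖w‖ ^ 2) (by simp)) x
  rw [← h]
  exact integral_congr_ae (Filter.Eventually.of_forall fun t => (hd t).norm_sq.deriv)

theorem norm_sq_le_integral {g g' : ℝ → ℂ} (hg : ContDiff ℝ ∞ g) (hc : HasCompactSupport g)
    (hd : ∀ t, HasDerivAt g (g' t) t) (hi : Integrable fun t => ‖g t‖ * ‖g' t‖) (x : ℝ) :
    ‖g x‖ ^ 2 ≤ 2 * ∫ t, ‖g t‖ * ‖g' t‖ := by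
  have hi2 : Integrable fun t => 2 * (‖g t‖ * ‖g' t‖) := hi.const_mul 2
  rw [norm_sq_eq_integral_Iic hg hc hd x, ← integral_const_mul]
  calc ∫ t in Set.Iic x, 2 * inner ℝ (g t) (g' t)
      ≤ ∫ t in Set.Iic x, 2 * (‖g t‖ * ‖g' t‖) := by
        refine (Real.le_norm_self _).trans (norm_integral_le_of_norm_le hi2.integrableOn
          (Filter.Eventually.of_forall fun t => ?_))
        rw [norm_mul, Real.norm_two]
        gcongr
        exact norm_inner_le_norm _ _
    _ ≤ ∫ t, 2 * (‖g t‖ * ‖g' t‖) :=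
        setIntegral_le_integral hi2 (Filter.Eventually.of_forall fun t => by positivity)

namespace IsTest

variable {φ ψ : Plane → ℂ}

theorem integrable_norm_mul_norm (hφ : IsTest φ) (hψ : IsTest ψ) :
    Integrable fun z => ‖φ z‖ * ‖ψ z‖ :=
  (hφ.memLp 2).norm.integrable_mul (hψ.memLp 2).norm

theorem integrable_inner (hφ : IsTest φ) (hψ : IsTest ψ) :
    Integrable fun z => (inner ℝ (φ z) (ψ z) : ℝ) :=
  (hφ.integrable_norm_mul_norm hψ).mono' (hφ.continuous.inner hψ.continuous).aestronglyMeasurable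
    (Filter.Eventually.of_forall fun _ => norm_inner_le_norm _ _)

/-- The one-dimensional bound on each horizontal line, integrated over `y`. -/
theorem integral_slice_norm_sq_le (hφ : IsTest φ) (x : ℝ) :
    ∫ y, ‖φ (x, y)‖ ^ 2 ≤ 2 * ∫ z, ‖φ z‖ * ‖_root_.dX φ z‖ := by
  have hi := hφ.integrable_norm_mul_norm hφ.dX
  rw [Measure.volume_eq_prod] at hi ⊢
  rw [integral_prod_symm _ hi, ← integral_const_mul]
  refine integral_mono ((hφ.memLp_right x 2).integrable_norm_pow (by simp))
    (hi.integral_prod_right.const_mul 2) fun y => ?_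
  exact norm_sq_le_integral (hφ.contDiff_left y) (hφ.hasCompactSupport_left y)
    (fun t => hφ.hasDerivAt_left t y)
    ((hφ.memLp_left y 2).norm.integrable_mul (hφ.dX.memLp_left y 2).norm) x

/-- The mixed derivative does not enter: `∂_y` is moved to the other factor. -/
theorem integral_slice_dY_norm_sq_le (hφ : IsTest φ) (x : ℝ) :
    ∫ y, ‖_root_.dY φ (x, y)‖ ^ 2 ≤
      2 * ∫ z, ‖_root_.dX φ z‖ * ‖_root_.dY (_root_.dY φ) z‖ := by
  have hi := hφ.dX.integrable_norm_mul_norm hφ.dY.dY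
  have hin := hφ.dY.integrable_inner hφ.dY.dX
  have hparts : ∀ t, ∫ y, (inner ℝ (_root_.dY φ (t, y)) (_root_.dX (_root_.dY φ) (t, y)) : ℝ) =
      -∫ y, (inner ℝ (_root_.dY (_root_.dY φ) (t, y)) (_root_.dX φ (t, y)) : ℝ) := by
    intro t
    have hint : ∀ {f g : Plane → ℂ}, IsTest f → IsTest g →
        Integrable fun y : ℝ => (inner ℝ (f (t, y)) (g (t, y)) : ℝ) := fun {f g} hf hg =>
      ((hf.memLp_right t 2).norm.integrable_mul (hg.memLp_right t 2).norm).mono'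
        ((hf.contDiff_right t).continuous.inner (hg.contDiff_right t).continuous).aestronglyMeasurable
        (Filter.Eventually.of_forall fun _ => norm_inner_le_norm _ _)
    rw [hφ.dX_dY]
    exact integral_bilinear_hasDerivAt_right_eq_neg_left_of_integrable (L := innerSL ℝ)
      (fun y _ => hφ.dY.hasDerivAt_right t y) (fun y _ => hφ.dX.hasDerivAt_right t y)
      (hint hφ.dY hφ.dX.dY) (hint hφ.dY.dY hφ.dX) (hint hφ.dY hφ.dX)
  rw [Measure.volume_eq_prod] at hi hin ⊢
  have hin' : Integrable (Function.uncurry fun y t =>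
      (2 * inner ℝ (_root_.dY φ (t, y)) (_root_.dX (_root_.dY φ) (t, y)) : ℝ))
      ((volume : Measure ℝ).prod ((volume : Measure ℝ).restrict (Set.Iic x))) := by
    refine Integrable.mono_measure (hin.swap.const_mul 2) ?_
    exact Measure.prod_mono le_rfl Measure.restrict_le_self
  -- The signed inner product is kept until Fubini has made `y` the inner variable; taking norms
  -- earlier would leave the mixed derivative, which the energy space does not control.
  calc ∫ y, ‖_root_.dY φ (x, y)‖ ^ 2
      = ∫ y, ∫ t in Set.Iic x,
          2 * inner ℝ (_root_.dY φ (t, y)) (_root_.dX (_root_.dY φ) (t, y)) := by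
        congr 1
        funext y
        exact norm_sq_eq_integral_Iic (hφ.dY.contDiff_left y) (hφ.dY.hasCompactSupport_left y)
          (fun t => hφ.dY.hasDerivAt_left t y) x
    _ = ∫ t in Set.Iic x, ∫ y,
          2 * inner ℝ (_root_.dY φ (t, y)) (_root_.dX (_root_.dY φ) (t, y)) :=
        integral_integral_swap hin'
    _ ≤ ∫ t in Set.Iic x, ∫ y, 2 * (‖_root_.dX φ (t, y)‖ * ‖_root_.dY (_root_.dY φ) (t, y)‖) := by
        refine integral_mono (hin'.integral_prod_right)
          ((hi.const_mul 2).integral_prod_left.mono_measure Measure.restrict_le_self) fun t => ?_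
        dsimp only
        rw [integral_const_mul, integral_const_mul, hparts]
        gcongr
        refine (neg_le_abs _).trans ?_
        rw [← Real.norm_eq_abs]
        refine norm_integral_le_of_norm_le
          ((hφ.dX.memLp_right t 2).norm.integrable_mul (hφ.dY.dY.memLp_right t 2).norm)
          (Filter.Eventually.of_forall fun y => ?_)
        rw [mul_comm]
        exact norm_inner_le_norm _ _
    _ ≤ ∫ t, ∫ y, 2 * (‖_root_.dX φ (t, y)‖ * ‖_root_.dY (_root_.dY φ) (t, y)‖) :=
        setIntegral_le_integral (hi.const_mul 2).integral_prod_left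
          (Filter.Eventually.of_forall fun t => integral_nonneg fun y => by positivity)
    _ = 2 * ∫ z, ‖_root_.dX φ z‖ * ‖_root_.dY (_root_.dY φ) z‖ ∂(volume.prod volume) := by
        rw [← integral_const_mul, integral_prod _ (hi.const_mul 2)]

/-- On the vertical line through `z`, `|φ|⁴ ≤ 4FH`, where `F` and `H` are the squared `L²` norms of
`φ` and `∂_yφ` on that line. The slice bounds give `F² ≤ 4ab` and `H² ≤ 4bc`, with `a, b, c` the
squared norms of `φ, ∂ₓφ, ∂_{yy}φ`; and `256 = 16 · 4 · 4`. -/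
theorem norm_pow_eight_le (hφ : IsTest φ) (z : Plane) :
    ‖φ z‖ ^ 8 ≤ 256 * (∫ z, ‖φ z‖ ^ 2) * (∫ z, ‖_root_.dX φ z‖ ^ 2) ^ 2 *
      ∫ z, ‖_root_.dY (_root_.dY φ) z‖ ^ 2 := by
  obtain ⟨x, y⟩ := z
  have h1 := norm_sq_le_integral (hφ.contDiff_right x) (hφ.hasCompactSupport_right x)
    (fun t => hφ.hasDerivAt_right x t)
    ((hφ.memLp_right x 2).norm.integrable_mul (hφ.dY.memLp_right x 2).norm) y
  have h2 := sq_integral_norm_mul_le (hφ.memLp_right x 2) (hφ.dY.memLp_right x 2)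
  have h3 := hφ.integral_slice_norm_sq_le x
  have h4 := hφ.integral_slice_dY_norm_sq_le x
  have h5 := sq_integral_norm_mul_le (hφ.memLp 2) (hφ.dX.memLp 2)
  have h6 := sq_integral_norm_mul_le (hφ.dX.memLp 2) (hφ.dY.dY.memLp 2)
  have n3 : 0 ≤ ∫ y, ‖φ (x, y)‖ ^ 2 := integral_nonneg fun y => by positivity
  have n4 : 0 ≤ ∫ y, ‖_root_.dY φ (x, y)‖ ^ 2 := integral_nonneg fun y => by positivity
  have n5 : 0 ≤ ∫ z, ‖φ z‖ ^ 2 := integral_nonneg fun y => by positivity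
  have n6 : 0 ≤ ∫ z, ‖_root_.dX φ z‖ ^ 2 := integral_nonneg fun y => by positivity
  generalize (∫ y, ‖φ (x, y)‖ ^ 2) = F at *
  generalize (∫ y, ‖_root_.dY φ (x, y)‖ ^ 2) = H at *
  generalize (∫ z, ‖φ z‖ ^ 2) = a at *
  generalize (∫ z, ‖_root_.dX φ z‖ ^ 2) = b at *
  generalize (∫ z, ‖_root_.dY (_root_.dY φ) z‖ ^ 2) = c at *
  generalize (∫ t, ‖φ (x, t)‖ * ‖_root_.dY φ (x, t)‖) = r at *
  generalize (∫ z, ‖φ z‖ * ‖_root_.dX φ z‖) = s at *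
  generalize (∫ z, ‖_root_.dX φ z‖ * ‖_root_.dY (_root_.dY φ) z‖) = t at *
  have h1' : ‖φ (x, y)‖ ^ 4 ≤ 4 * (F * H) := by
    calc ‖φ (x, y)‖ ^ 4 = (‖φ (x, y)‖ ^ 2) ^ 2 := by ring
      _ ≤ (2 * r) ^ 2 := by gcongr
      _ ≤ _ := by linarith
  have hF : F ^ 2 ≤ 4 * (a * b) := by
    calc F ^ 2 ≤ (2 * s) ^ 2 := by gcongr
      _ ≤ _ := by linarith
  have hH : H ^ 2 ≤ 4 * (b * c) := by
    calc H ^ 2 ≤ (2 * t) ^ 2 := by gcongr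
      _ ≤ _ := by linarith
  calc ‖φ (x, y)‖ ^ 8 = (‖φ (x, y)‖ ^ 4) ^ 2 := by ring
    _ ≤ (4 * (F * H)) ^ 2 := by gcongr
    _ = 16 * (F ^ 2 * H ^ 2) := by ring
    _ ≤ 16 * ((4 * (a * b)) * (4 * (b * c))) := by gcongr
    _ = _ := by ring

end IsTest

/-! ### Norms in `L2` as integrals -/

theorem L2.norm_sq_eq_integral (f : L2) : ‖f‖ ^ 2 = ∫ z, ‖f z‖ ^ 2 := by
  have h : ((‖f‖ ^ 2 : ℝ) : ℂ) = ((∫ z, ‖f z‖ ^ 2 : ℝ) : ℂ) := by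
    have h1 := inner_self_eq_norm_sq_to_K (𝕜 := ℂ) f
    rw [L2.inner_def] at h1
    rw [← integral_complex_ofReal]
    push_cast
    refine Eq.trans h1.symm (integral_congr_ae (Filter.Eventually.of_forall fun z => ?_))
    exact inner_self_eq_norm_sq_to_K (𝕜 := ℂ) (f z)
  exact_mod_cast h

theorem L2.integrable_norm_sq (f : L2) : Integrable fun z => ‖f z‖ ^ 2 :=
  (Lp.memLp f).integrable_norm_pow (by simp)

theorem IsTest.norm_sq_toLp {φ : Plane → ℂ} (hφ : IsTest φ) :
    ‖((hφ.memLp 2).toLp φ : L2)‖ ^ 2 = ∫ z, ‖φ z‖ ^ 2 := by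
  rw [L2.norm_sq_eq_integral]
  refine integral_congr_ae ?_
  filter_upwards [(hφ.memLp 2).coeFn_toLp] with z hz
  rw [hz]

/-! ### Affine changes of variables -/

/-- The map `(x, y) ↦ (l x + a₁, m y + a₂)`. -/
def affine (l m : ℝ) (a z : Plane) : Plane := (l * z.1 + a.1, m * z.2 + a.2)

theorem continuous_affine (l m : ℝ) (a : Plane) : Continuous (affine l m a) := by
  unfold affine
  fun_prop

theorem map_affine {l m : ℝ} (hl : 0 < l) (hm : 0 < m) (a : Plane) :
    Measure.map (affine l m a) volume = ENNReal.ofReal (l * m)⁻¹ • volume := by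
  have h1 : affine l m a = (fun z => z + a) ∘ Prod.map (fun x => l * x) (fun y => m * y) := by
    funext z
    rfl
  have hml : Measurable fun x : ℝ => l * x := measurable_const_mul l
  have hmm : Measurable fun x : ℝ => m * x := measurable_const_mul m
  rw [h1, ← Measure.map_map (measurable_add_const a) (hml.prodMap hmm), Measure.volume_eq_prod,
    ← Measure.map_prod_map _ _ hml hmm, Real.map_volume_mul_left hl.ne',
    Real.map_volume_mul_left hm.ne', Measure.prod_smul_left, Measure.prod_smul_right, smul_smul,
    ← Measure.volume_eq_prod, Measure.map_smul, map_add_right_eq_self,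
    ← ENNReal.ofReal_mul (abs_nonneg _), abs_of_pos (inv_pos.2 hl), abs_of_pos (inv_pos.2 hm),
    mul_inv]

theorem quasiMeasurePreserving_affine {l m : ℝ} (hl : 0 < l) (hm : 0 < m) (a : Plane) :
    Measure.QuasiMeasurePreserving (affine l m a) volume volume :=
  ⟨(continuous_affine l m a).measurable, by
    rw [map_affine hl hm]
    exact Measure.smul_absolutelyContinuous⟩

theorem integral_comp_affine {l m : ℝ} (hl : 0 < l) (hm : 0 < m) (a : Plane) {g : Plane → ℝ}
    (hg : AEStronglyMeasurable g volume) :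
    ∫ z, g (affine l m a z) = (l * m)⁻¹ * ∫ z, g z := by
  rw [← integral_map (continuous_affine l m a).aemeasurable, map_affine hl hm, integral_smul_measure,
    ENNReal.toReal_ofReal (by positivity), smul_eq_mul]
  rw [map_affine hl hm]
  exact hg.mono_ac Measure.smul_absolutelyContinuous

theorem MeasureTheory.MemLp.comp_affine {l m : ℝ} (hl : 0 < l) (hm : 0 < m) (a : Plane)
    {f : Plane → ℂ} {q : ENNReal} (hf : MemLp f q volume) :
    MemLp (f ∘ affine l m a) q volume := by
  refine MemLp.comp_of_map ?_ (continuous_affine l m a).aemeasurable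
  rw [map_affine hl hm]
  exact hf.smul_measure ENNReal.ofReal_ne_top

theorem IsTest.comp_affine {φ : Plane → ℂ} (hφ : IsTest φ) {l m : ℝ} (hl : 0 < l) (hm : 0 < m)
    (a : Plane) : IsTest (φ ∘ affine l m a) := by
  have hc : ContDiff ℝ ∞ (affine l m a) := by
    unfold affine
    fun_prop
  have hinv : Function.LeftInverse
      (affine l⁻¹ m⁻¹ (-(l⁻¹ * a.1), -(m⁻¹ * a.2))) (affine l m a) := by
    intro z
    ext <;> simp [affine] <;> field_simp <;> ring
  have hinv' : Function.RightInverse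
      (affine l⁻¹ m⁻¹ (-(l⁻¹ * a.1), -(m⁻¹ * a.2))) (affine l m a) := by
    intro z
    ext <;> simp [affine] <;> field_simp <;> ring
  let e : Plane ≃ₜ Plane := ⟨⟨_, _, hinv, hinv'⟩, continuous_affine _ _ _, continuous_affine _ _ _⟩
  exact ⟨hφ.1.comp hc, hφ.2.comp_homeomorph e⟩

theorem hasFDerivAt_affine (l m : ℝ) (a z : Plane) :
    HasFDerivAt (affine l m a) ((l • ContinuousLinearMap.fst ℝ ℝ ℝ).prod
      (m • ContinuousLinearMap.snd ℝ ℝ ℝ)) z :=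
  ((hasFDerivAt_fst.const_mul l).add_const a.1).prodMk ((hasFDerivAt_snd.const_mul m).add_const a.2)

theorem dX_comp_affine {φ : Plane → ℂ} (hφ : IsTest φ) (l m : ℝ) (a : Plane) :
    dX (φ ∘ affine l m a) = (l : ℂ) • (dX φ ∘ affine l m a) := by
  funext z
  have h := ((hφ.differentiable (affine l m a z)).hasFDerivAt.comp z (hasFDerivAt_affine l m a z)).fderiv
  have e : ((l • ContinuousLinearMap.fst ℝ ℝ ℝ).prod (m • ContinuousLinearMap.snd ℝ ℝ ℝ)) (1, 0) =
      l • ((1, 0) : Plane) := by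
    ext <;> simp
  change fderiv ℝ (φ ∘ affine l m a) z (1, 0) = (l : ℂ) * fderiv ℝ φ (affine l m a z) (1, 0)
  rw [h, ContinuousLinearMap.comp_apply, e, map_smul, Complex.real_smul]

theorem dY_comp_affine {φ : Plane → ℂ} (hφ : IsTest φ) (l m : ℝ) (a : Plane) :
    dY (φ ∘ affine l m a) = (m : ℂ) • (dY φ ∘ affine l m a) := by
  funext z
  have h := ((hφ.differentiable (affine l m a z)).hasFDerivAt.comp z (hasFDerivAt_affine l m a z)).fderiv
  have e : ((l • ContinuousLinearMap.fst ℝ ℝ ℝ).prod (m • ContinuousLinearMap.snd ℝ ℝ ℝ)) (0, 1) =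
      m • ((0, 1) : Plane) := by
    ext <;> simp
  change fderiv ℝ (φ ∘ affine l m a) z (0, 1) = (m : ℂ) * fderiv ℝ φ (affine l m a z) (0, 1)
  rw [h, ContinuousLinearMap.comp_apply, e, map_smul, Complex.real_smul]

theorem L2.norm_sq_toLp_comp_affine {l m : ℝ} (hl : 0 < l) (hm : 0 < m) (a : Plane) (f : L2) :
    ‖(((Lp.memLp f).comp_affine hl hm a).toLp _ : L2)‖ ^ 2 = (l * m)⁻¹ * ‖f‖ ^ 2 := by
  have hm2 : AEStronglyMeasurable (fun z => ‖f z‖ ^ 2) volume :=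
    (Lp.aestronglyMeasurable f).norm.pow 2
  rw [L2.norm_sq_eq_integral, L2.norm_sq_eq_integral, ← integral_comp_affine hl hm a hm2]
  refine integral_congr_ae ?_
  filter_upwards [((Lp.memLp f).comp_affine hl hm a).coeFn_toLp] with z hz
  rw [hz]
  rfl

/-- Composition with an affine map, as an operator on `L²`. -/
noncomputable def compAffine {l m : ℝ} (hl : 0 < l) (hm : 0 < m) (a : Plane) : L2 →L[ℂ] L2 :=
  LinearMap.mkContinuous
    { toFun := fun f => ((Lp.memLp f).comp_affine hl hm a).toLp _
      map_add' := fun f g => by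
        rw [← MemLp.toLp_add]
        exact MemLp.toLp_congr _ _
          ((quasiMeasurePreserving_affine hl hm a).ae_eq_comp (Lp.coeFn_add f g))
      map_smul' := fun c f => by
        rw [RingHom.id_apply, ← MemLp.toLp_const_smul]
        exact MemLp.toLp_congr _ _
          ((quasiMeasurePreserving_affine hl hm a).ae_eq_comp (Lp.coeFn_smul c f)) }
    (√(l * m)⁻¹) fun f => by
      refine le_of_sq_le_sq ?_ (by positivity)
      rw [mul_pow, Real.sq_sqrt (by positivity)]
      exact (L2.norm_sq_toLp_comp_affine hl hm a f).le

section

variable {l m : ℝ} (hl : 0 < l) (hm : 0 < m) (a : Plane)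

theorem norm_sq_compAffine (f : L2) : ‖compAffine hl hm a f‖ ^ 2 = (l * m)⁻¹ * ‖f‖ ^ 2 :=
  L2.norm_sq_toLp_comp_affine hl hm a f

theorem coeFn_compAffine (f : L2) :
    (compAffine hl hm a f : Plane → ℂ) =ᵐ[volume] f ∘ affine l m a :=
  ((Lp.memLp f).comp_affine hl hm a).coeFn_toLp

theorem coeFn_compAffine_of_ae_eq {f : L2} {g : Plane → ℂ} (h : (f : Plane → ℂ) =ᵐ[volume] g) :
    (compAffine hl hm a f : Plane → ℂ) =ᵐ[volume] g ∘ affine l m a :=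
  (coeFn_compAffine hl hm a f).trans ((quasiMeasurePreserving_affine hl hm a).ae_eq_comp h)

/-- The action of an affine map on triples `(u, ∂ₓu, ∂_{yy}u)`. -/
noncomputable def rescaleTriple : L2 × L2 × L2 →L[ℂ] L2 × L2 × L2 :=
  (compAffine hl hm a).prodMap
    (((l : ℂ) • compAffine hl hm a).prodMap (((m : ℂ) ^ 2) • compAffine hl hm a))

theorem rescaleTriple_mem_testGraph {T : L2 × L2 × L2} (hT : T ∈ testGraph) :
    rescaleTriple hl hm a T ∈ testGraph := by
  obtain ⟨φ, hφ, h1, h2, h3⟩ := hT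
  refine ⟨φ ∘ affine l m a, hφ.comp_affine hl hm a, coeFn_compAffine_of_ae_eq hl hm a h1, ?_, ?_⟩
  · rw [dX_comp_affine hφ]
    exact (Lp.coeFn_smul _ _).trans ((coeFn_compAffine_of_ae_eq hl hm a h2).const_smul _)
  · rw [dY_comp_affine hφ, dY_smul _ (hφ.dY.comp_affine hl hm a), dY_comp_affine hφ.dY, smul_smul,
      ← sq]
    exact (Lp.coeFn_smul _ _).trans ((coeFn_compAffine_of_ae_eq hl hm a h3).const_smul _)

theorem rescaleTriple_mem (u : H12) :
    rescaleTriple hl hm a u ∈ testGraph.topologicalClosure :=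
  map_mem_closure (rescaleTriple hl hm a).continuous u.2 fun _ hT =>
    rescaleTriple_mem_testGraph hl hm a hT

/-- `u ↦ u(l x + a₁, m y + a₂)` on `H^{1,2}`. -/
noncomputable def H12.rescale : H12 →L[ℂ] H12 :=
  ((rescaleTriple hl hm a).comp (Submodule.subtypeL _)).codRestrict _ (rescaleTriple_mem hl hm a)

end

namespace H12

section

variable {l m : ℝ} (hl : 0 < l) (hm : 0 < m) (a : Plane) (u : H12)

theorem fn_rescale : (rescale hl hm a u).fn = compAffine hl hm a u.fn := rfl

theorem dx_rescale : (rescale hl hm a u).dx = (l : ℂ) • compAffine hl hm a u.dx := rfl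

theorem dyy_rescale : (rescale hl hm a u).dyy = ((m : ℂ) ^ 2) • compAffine hl hm a u.dyy := rfl

theorem norm_sq_fn_rescale : ‖(rescale hl hm a u).fn‖ ^ 2 = (l * m)⁻¹ * ‖u.fn‖ ^ 2 :=
  norm_sq_compAffine hl hm a u.fn

/-- The chain rule contributes `l²` and the Jacobian `(lm)⁻¹`; for `∂_{yy}` the chain rule
contributes `m⁴`. -/
theorem norm_sq_dx_rescale : ‖(rescale hl hm a u).dx‖ ^ 2 = l / m * ‖u.dx‖ ^ 2 := by
  rw [dx_rescale, norm_smul, mul_pow, norm_sq_compAffine, Complex.norm_real, Real.norm_eq_abs,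
    sq_abs]
  field_simp

theorem norm_sq_dyy_rescale : ‖(rescale hl hm a u).dyy‖ ^ 2 = m ^ 3 / l * ‖u.dyy‖ ^ 2 := by
  rw [dyy_rescale, norm_smul, mul_pow, norm_sq_compAffine, norm_pow, Complex.norm_real,
    Real.norm_eq_abs, sq_abs]
  field_simp

theorem normPow_rescale (p : ℝ) : (rescale hl hm a u).normPow p = (l * m)⁻¹ * u.normPow p := by
  unfold normPow
  rw [← integral_comp_affine hl hm a]
  · refine integral_congr_ae ?_
    filter_upwards [coeFn_compAffine hl hm a u.fn] with z hz
    rw [fn_rescale, hz]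
    rfl
  · exact ((Lp.aestronglyMeasurable u.fn).norm.aemeasurable.pow_const p).aestronglyMeasurable

end

/-! ### Test functions in `H^{1,2}` -/

/-- A test function as an element of `H^{1,2}`. -/
noncomputable def ofTest {φ : Plane → ℂ} (hφ : IsTest φ) : H12 :=
  ⟨((hφ.memLp 2).toLp φ, (hφ.dX.memLp 2).toLp (dX φ), (hφ.dY.dY.memLp 2).toLp (dY (dY φ))),
    subset_closure ⟨φ, hφ, (hφ.memLp 2).coeFn_toLp, (hφ.dX.memLp 2).coeFn_toLp,
      (hφ.dY.dY.memLp 2).coeFn_toLp⟩⟩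

variable {φ : Plane → ℂ}

theorem fn_ofTest (hφ : IsTest φ) : ((ofTest hφ).fn : Plane → ℂ) =ᵐ[volume] φ :=
  (hφ.memLp 2).coeFn_toLp

theorem dx_ofTest (hφ : IsTest φ) : ((ofTest hφ).dx : Plane → ℂ) =ᵐ[volume] _root_.dX φ :=
  (hφ.dX.memLp 2).coeFn_toLp

theorem dyy_ofTest (hφ : IsTest φ) :
    ((ofTest hφ).dyy : Plane → ℂ) =ᵐ[volume] _root_.dY (_root_.dY φ) :=
  (hφ.dY.dY.memLp 2).coeFn_toLp

theorem continuous_fn : Continuous fn := continuous_fst.comp continuous_subtype_val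

theorem continuous_dx : Continuous dx :=
  (continuous_fst.comp continuous_snd).comp continuous_subtype_val

theorem continuous_dyy : Continuous dyy :=
  (continuous_snd.comp continuous_snd).comp continuous_subtype_val

theorem exists_ofTest_eq {T : L2 × L2 × L2} (hT : T ∈ testGraph) :
    ∃ φ, ∃ hφ : IsTest φ, (ofTest hφ : L2 × L2 × L2) = T := by
  obtain ⟨φ, hφ, h1, h2, h3⟩ := hT
  exact ⟨φ, hφ, Prod.ext (Lp.ext ((fn_ofTest hφ).trans h1.symm))
    (Prod.ext (Lp.ext ((dx_ofTest hφ).trans h2.symm)) (Lp.ext ((dyy_ofTest hφ).trans h3.symm)))⟩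

theorem exists_tendsto_ofTest (u : H12) :
    ∃ φ : ℕ → Plane → ℂ, ∃ hφ : ∀ n, IsTest (φ n),
      Filter.Tendsto (fun n => ofTest (hφ n)) Filter.atTop (nhds u) := by
  obtain ⟨T, hT, hlim⟩ := mem_closure_iff_seq_limit.1 u.2
  choose φ hφ h using fun n => exists_ofTest_eq (hT n)
  refine ⟨φ, hφ, tendsto_subtype_rng.2 ?_⟩
  simpa only [h] using hlim

/-- A closed property that holds for test functions holds on `H^{1,2}`. -/
theorem closed_induction {Q : H12 → Prop} (hQ : IsClosed {u | Q u})
    (h : ∀ (φ : Plane → ℂ) (hφ : IsTest φ), Q (ofTest hφ)) (u : H12) : Q u := by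
  obtain ⟨φ, hφ, hlim⟩ := exists_tendsto_ofTest u
  exact hQ.mem_of_tendsto hlim (Filter.Eventually.of_forall fun n => h _ (hφ n))

theorem rescale_ofTest {l m : ℝ} (hl : 0 < l) (hm : 0 < m) (a : Plane) (hφ : IsTest φ) :
    rescale hl hm a (ofTest hφ) = ofTest (hφ.comp_affine hl hm a) :=
  fn_injective <| Lp.ext <|
    (coeFn_compAffine_of_ae_eq hl hm a (fn_ofTest hφ)).trans (fn_ofTest _).symm

end H12

/-! ### Point evaluation -/

theorem IsTest.norm_le_two_mul_norm {φ : Plane → ℂ} (hφ : IsTest φ) (z : Plane) :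
    ‖φ z‖ ≤ 2 * ‖H12.ofTest hφ‖ := by
  have h := hφ.norm_pow_eight_le z
  rw [← hφ.norm_sq_toLp, ← hφ.dX.norm_sq_toLp, ← hφ.dY.dY.norm_sq_toLp] at h
  have h1 : ‖((hφ.memLp 2).toLp φ : L2)‖ ≤ ‖H12.ofTest hφ‖ :=
    norm_fst_le (H12.ofTest hφ : L2 × L2 × L2)
  have h2 : ‖((hφ.dX.memLp 2).toLp (_root_.dX φ) : L2)‖ ≤ ‖H12.ofTest hφ‖ :=
    (norm_fst_le _).trans (norm_snd_le (H12.ofTest hφ : L2 × L2 × L2))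
  have h3 : ‖((hφ.dY.dY.memLp 2).toLp (_root_.dY (_root_.dY φ)) : L2)‖ ≤ ‖H12.ofTest hφ‖ :=
    (norm_snd_le _).trans (norm_snd_le (H12.ofTest hφ : L2 × L2 × L2))
  refine le_of_pow_le_pow_left₀ (n := 8) (by norm_num) (by positivity) (h.trans ?_)
  calc _ ≤ 256 * ‖H12.ofTest hφ‖ ^ 2 * (‖H12.ofTest hφ‖ ^ 2) ^ 2 * ‖H12.ofTest hφ‖ ^ 2 := by
        gcongr
    _ = _ := by ring

theorem IsTest.eq_of_ae_eq {φ ψ : Plane → ℂ} (hφ : IsTest φ) (hψ : IsTest ψ)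
    (h : φ =ᵐ[volume] ψ) : φ = ψ :=
  (Continuous.ae_eq_iff_eq volume hφ.continuous hψ.continuous).1 h

/-- An almost-everywhere class contains at most one test function, so choosing representatives is
linear; the sup bound gives continuity. -/
theorem exists_evalZero_testGraph : ∃ f : testGraph →L[ℂ] ℂ,
    ∀ (T : testGraph) (φ : Plane → ℂ), IsTest φ → (T.1.1 : Plane → ℂ) =ᵐ[volume] φ → f T = φ 0 := by
  choose φ hφ h using fun T : testGraph => H12.exists_ofTest_eq T.2
  have hae : ∀ T : testGraph, (T.1.1 : Plane → ℂ) =ᵐ[volume] φ T := fun T => by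
    have := H12.fn_ofTest (hφ T)
    rwa [H12.fn, h T] at this
  have hadd : ∀ S T, φ (S + T) 0 = φ S 0 + φ T 0 := fun S T =>
    congrFun ((hφ (S + T)).eq_of_ae_eq ((hφ S).add (hφ T))
      ((hae (S + T)).symm.trans ((Lp.coeFn_add S.1.1 T.1.1).trans ((hae S).add (hae T))))) 0
  have hsmul : ∀ (c : ℂ) T, φ (c • T) 0 = c • φ T 0 := fun c T =>
    congrFun ((hφ (c • T)).eq_of_ae_eq ((hφ T).const_smul c)
      ((hae (c • T)).symm.trans ((Lp.coeFn_smul c T.1.1).trans ((hae T).const_smul c)))) 0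
  let g : testGraph →ₗ[ℂ] ℂ := ⟨⟨fun T => φ T 0, hadd⟩, hsmul⟩
  have hg : ∀ T, ‖g T‖ ≤ 2 * ‖T‖ := by
    intro T
    have h1 := (hφ T).norm_le_two_mul_norm 0
    rw [Submodule.coe_norm, h T] at h1
    exact h1
  refine ⟨g.mkContinuous 2 hg, fun T ψ hψ hT => ?_⟩
  rw [LinearMap.mkContinuous_apply]
  exact congrFun ((hφ T).eq_of_ae_eq hψ ((hae T).symm.trans hT)) 0

/-- Evaluation at the origin extends from test functions to a continuous linear functional. -/
theorem exists_evalZero : ∃ ℓ : L2 × L2 × L2 →L[ℂ] ℂ,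
    ∀ (φ : Plane → ℂ) (hφ : IsTest φ), ℓ (H12.ofTest hφ) = φ 0 := by
  obtain ⟨f, hf⟩ := exists_evalZero_testGraph
  -- Hahn–Banach: a functional on the whole product can be applied directly to weakly convergent
  -- triples.
  obtain ⟨ℓ, hℓ, -⟩ := exists_extension_norm_eq testGraph f
  refine ⟨ℓ, fun ψ hψ => ?_⟩
  have hmem : (H12.ofTest hψ : L2 × L2 × L2) ∈ testGraph :=
    ⟨ψ, hψ, H12.fn_ofTest hψ, H12.dx_ofTest hψ, H12.dyy_ofTest hψ⟩
  exact (hℓ ⟨_, hmem⟩).trans (hf _ ψ hψ (H12.fn_ofTest hψ))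

/-- Evaluation at the origin. -/
noncomputable def evalZero : L2 × L2 × L2 →L[ℂ] ℂ := exists_evalZero.choose

theorem evalZero_ofTest {φ : Plane → ℂ} (hφ : IsTest φ) : evalZero (H12.ofTest hφ) = φ 0 :=
  exists_evalZero.choose_spec φ hφ

namespace H12

/-- Translation by `a`. -/
noncomputable def translate (a : Plane) : H12 →L[ℂ] H12 := rescale one_pos one_pos a

theorem norm_sq_fn_translate (a : Plane) (u : H12) : ‖(translate a u).fn‖ ^ 2 = ‖u.fn‖ ^ 2 := by
  exact (norm_sq_fn_rescale one_pos one_pos a u).trans (by norm_num)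

theorem norm_sq_dx_translate (a : Plane) (u : H12) : ‖(translate a u).dx‖ ^ 2 = ‖u.dx‖ ^ 2 := by
  exact (norm_sq_dx_rescale one_pos one_pos a u).trans (by norm_num)

theorem norm_sq_dyy_translate (a : Plane) (u : H12) : ‖(translate a u).dyy‖ ^ 2 = ‖u.dyy‖ ^ 2 := by
  exact (norm_sq_dyy_rescale one_pos one_pos a u).trans (by norm_num)

theorem normPow_translate (p : ℝ) (a : Plane) (u : H12) :
    (translate a u).normPow p = u.normPow p := by
  have h := normPow_rescale one_pos one_pos a u p
  rwa [mul_one, inv_one, one_mul] at h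

/-- The continuous representative of an element of `H^{1,2}`. -/
noncomputable def value (z : Plane) : H12 →L[ℂ] ℂ :=
  (evalZero.comp (Submodule.subtypeL _)).comp (translate z)

theorem value_apply (z : Plane) (u : H12) : value z u = evalZero (translate z u) := rfl

theorem value_ofTest {φ : Plane → ℂ} (hφ : IsTest φ) (z : Plane) : value z (ofTest hφ) = φ z := by
  rw [value_apply, translate, rescale_ofTest, evalZero_ofTest]
  simp [affine]

theorem norm_value_pow_eight_le (z : Plane) (u : H12) :
    ‖value z u‖ ^ 8 ≤ 256 * ‖u.fn‖ ^ 2 * (‖u.dx‖ ^ 2) ^ 2 * ‖u.dyy‖ ^ 2 := by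
  refine closed_induction (Q := fun u => ‖value z u‖ ^ 8 ≤
    256 * ‖u.fn‖ ^ 2 * (‖u.dx‖ ^ 2) ^ 2 * ‖u.dyy‖ ^ 2) (isClosed_le ?_ ?_) (fun φ hφ => ?_) u
  · exact ((value z).continuous.norm.pow 8)
  · have := continuous_fn
    have := continuous_dx
    have := continuous_dyy
    fun_prop
  · have h := hφ.norm_pow_eight_le z
    rw [← hφ.norm_sq_toLp, ← hφ.dX.norm_sq_toLp, ← hφ.dY.dY.norm_sq_toLp] at h
    rw [value_ofTest]
    exact h

/-- Approximating test functions converge to `value z u` at every point and, along a subsequence, to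
`u.fn` almost everywhere. -/
theorem fn_ae_eq_value (u : H12) : (u.fn : Plane → ℂ) =ᵐ[volume] fun z => value z u := by
  obtain ⟨φ, hφ, hlim⟩ := exists_tendsto_ofTest u
  have h1 : Filter.Tendsto (fun n => (ofTest (hφ n)).fn) Filter.atTop (nhds u.fn) :=
    (continuous_fn.tendsto u).comp hlim
  obtain ⟨ns, hns, hae⟩ := (tendstoInMeasure_of_tendsto_Lp h1).exists_seq_tendsto_ae
  filter_upwards [hae, ae_all_iff.2 fun n => fn_ofTest (hφ n)] with z hz hz2
  refine tendsto_nhds_unique hz ?_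
  have h2 : Filter.Tendsto (fun n => value z (ofTest (hφ (ns n)))) Filter.atTop
      (nhds (value z u)) :=
    (((value z).continuous.tendsto u).comp hlim).comp hns.tendsto_atTop
  refine h2.congr fun n => ?_
  rw [value_ofTest, hz2]

end H12

/-! ### The Brezis–Lieb lemma -/

/-- Take `d > 0` with `(1 + d)^p < 1 + ε`. If `s ≤ dt` the first term suffices; otherwise `t ≤ s/d`
and the second does. -/
theorem exists_add_rpow_le {p ε : ℝ} (hp : 0 < p) (hε : 0 < ε) :
    ∃ C : ℝ, 0 ≤ C ∧ ∀ s t : ℝ, 0 ≤ s → 0 ≤ t → (s + t) ^ p ≤ (1 + ε) * t ^ p + C * s ^ p := by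
  have hcont : ContinuousAt (fun d : ℝ => (1 + d) ^ p) 0 :=
    (continuousAt_const.add continuousAt_id).rpow_const (Or.inr hp.le)
  have hev : ∀ᶠ d : ℝ in nhdsWithin 0 (Set.Ioi 0), (1 + d) ^ p < 1 + ε :=
    (hcont.tendsto.mono_left nhdsWithin_le_nhds).eventually_lt_const (by simpa using hε)
  obtain ⟨d, hd, hd0⟩ := (hev.and self_mem_nhdsWithin).exists
  have hd0 : 0 < d := hd0
  refine ⟨(1 + d⁻¹) ^ p, by positivity, fun s t hs ht => ?_⟩
  rcases le_total s (d * t) with h | h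
  · calc (s + t) ^ p ≤ ((1 + d) * t) ^ p := by
          apply Real.rpow_le_rpow (by positivity) (by linarith) hp.le
      _ = (1 + d) ^ p * t ^ p := Real.mul_rpow (by positivity) ht
      _ ≤ (1 + ε) * t ^ p := by gcongr
      _ ≤ _ := le_add_of_nonneg_right (by positivity)
  · have h2 : t ≤ d⁻¹ * s := by
      rw [inv_mul_eq_div, le_div_iff₀ hd0]
      linarith
    calc (s + t) ^ p ≤ ((1 + d⁻¹) * s) ^ p := by
          apply Real.rpow_le_rpow (by positivity) (by linarith) hp.le
      _ = (1 + d⁻¹) ^ p * s ^ p := Real.mul_rpow (by positivity) hs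
      _ ≤ _ := le_add_of_nonneg_left (by positivity)

theorem exists_abs_norm_rpow_sub_le {p ε : ℝ} (hp : 0 < p) (hε : 0 < ε) :
    ∃ C : ℝ, 0 ≤ C ∧ ∀ a b : ℂ, |‖a + b‖ ^ p - ‖b‖ ^ p| ≤ ε * ‖b‖ ^ p + C * ‖a‖ ^ p := by
  obtain ⟨η, hη0, hη1, hη⟩ : ∃ η : ℝ, 0 < η ∧ η ≤ 1 ∧ 2 * η ≤ ε :=
    ⟨min 1 (ε / 2), by positivity, min_le_left _ _, by linarith [min_le_right 1 (ε / 2)]⟩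
  obtain ⟨C, hC, h⟩ := exists_add_rpow_le hp hη0
  have hn : ∀ a b : ℂ, ‖a + b‖ ^ p ≤ (1 + η) * ‖b‖ ^ p + C * ‖a‖ ^ p := fun a b =>
    (Real.rpow_le_rpow (norm_nonneg _) (norm_add_le a b) hp.le).trans
      (h _ _ (norm_nonneg a) (norm_nonneg b))
  refine ⟨2 * C, by positivity, fun a b => ?_⟩
  have h1 := hn a b
  -- Writing `b = -a + (a + b)` gives the reverse estimate; `η ≤ 1` and `2η ≤ ε` absorb the factor
  -- `η(1 + η)` that arises on returning from `a + b` to `b`.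
  have h2 := hn (-a) (a + b)
  rw [neg_add_cancel_left, norm_neg] at h2
  have ha : 0 ≤ C * ‖a‖ ^ p := by positivity
  have hb : 0 ≤ ‖b‖ ^ p := by positivity
  have hb2 : 2 * η * ‖b‖ ^ p ≤ ε * ‖b‖ ^ p := by gcongr
  have hb3 : 0 ≤ η * ‖b‖ ^ p := by positivity
  have h3 : η * ‖a + b‖ ^ p ≤ η * ((1 + η) * ‖b‖ ^ p + C * ‖a‖ ^ p) := by gcongr
  have h4 : η * (η * ‖b‖ ^ p) ≤ 1 * (η * ‖b‖ ^ p) := by gcongr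
  have h5 : η * (C * ‖a‖ ^ p) ≤ 1 * (C * ‖a‖ ^ p) := by gcongr
  rw [abs_le]
  constructor <;> nlinarith

/-- The **Brezis–Lieb lemma**. -/
theorem tendsto_integral_norm_rpow_sub {α : Type*} [MeasurableSpace α] {μ : Measure α} {p : ℝ}
    (hp : 0 < p) {f : ℕ → α → ℂ} {g : α → ℂ} (hfm : ∀ n, AEStronglyMeasurable (f n) μ)
    (hgm : AEStronglyMeasurable g μ) (hfi : ∀ n, Integrable (fun a => ‖f n a‖ ^ p) μ)
    (hgi : Integrable (fun a => ‖g a‖ ^ p) μ) {K : ℝ} (hK : ∀ n, ∫ a, ‖f n a‖ ^ p ∂μ ≤ K)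
    (hlim : ∀ᵐ a ∂μ, Filter.Tendsto (fun n => f n a) Filter.atTop (nhds (g a))) :
    Filter.Tendsto (fun n => ∫ a, ‖f n a‖ ^ p ∂μ - ∫ a, ‖f n a - g a‖ ^ p ∂μ) Filter.atTop
      (nhds (∫ a, ‖g a‖ ^ p ∂μ)) := by
  have hpm : ∀ {h : α → ℂ}, AEStronglyMeasurable h μ →
      AEStronglyMeasurable (fun a => ‖h a‖ ^ p) μ := fun hh =>
    (hh.norm.aemeasurable.pow_const p).aestronglyMeasurable
  -- The case `ε = 1` serves only for integrability of `‖f n - g‖^p` and a bound on its integral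
  -- uniform in `n`.
  obtain ⟨C₁, hC₁, h1⟩ := exists_abs_norm_rpow_sub_le hp one_pos
  have hb1 : ∀ n a, ‖f n a - g a‖ ^ p ≤ 2 * ‖f n a‖ ^ p + C₁ * ‖g a‖ ^ p := fun n a => by
    have := (abs_le.1 (h1 (-g a) (f n a))).2
    rw [norm_neg, neg_add_eq_sub] at this
    linarith
  have hdi : ∀ n, Integrable (fun a => ‖f n a - g a‖ ^ p) μ := fun n =>
    (((hfi n).const_mul 2).add (hgi.const_mul C₁)).mono' (hpm ((hfm n).sub hgm))
      (Filter.Eventually.of_forall fun a => by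
        rw [Real.norm_of_nonneg (by positivity)]
        exact hb1 n a)
  set K' : ℝ := 2 * K + C₁ * ∫ a, ‖g a‖ ^ p ∂μ
  have hK' : ∀ n, ∫ a, ‖f n a - g a‖ ^ p ∂μ ≤ K' := fun n => by
    calc ∫ a, ‖f n a - g a‖ ^ p ∂μ ≤ ∫ a, 2 * ‖f n a‖ ^ p + C₁ * ‖g a‖ ^ p ∂μ :=
          integral_mono (hdi n) (((hfi n).const_mul 2).add (hgi.const_mul C₁)) (hb1 n)
      _ = 2 * ∫ a, ‖f n a‖ ^ p ∂μ + C₁ * ∫ a, ‖g a‖ ^ p ∂μ := by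
          rw [integral_add ((hfi n).const_mul 2) (hgi.const_mul C₁), integral_const_mul,
            integral_const_mul]
      _ ≤ K' := by
          have := hK n
          simp only [K']
          linarith
  have hK'0 : 0 ≤ K' := (integral_nonneg fun a => by positivity).trans (hK' 0)
  set D : ℕ → α → ℝ := fun n a => ‖f n a‖ ^ p - ‖f n a - g a‖ ^ p - ‖g a‖ ^ p
  have hDi : ∀ n, Integrable (D n) μ := fun n => ((hfi n).sub (hdi n)).sub hgi
  have hDlim : ∀ᵐ a ∂μ, Filter.Tendsto (fun n => D n a) Filter.atTop (nhds 0) := by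
    filter_upwards [hlim] with a ha
    have e1 : Filter.Tendsto (fun n => ‖f n a‖ ^ p) Filter.atTop (nhds (‖g a‖ ^ p)) :=
      ha.norm.rpow_const (Or.inr hp.le)
    have e2 : Filter.Tendsto (fun n => ‖f n a - g a‖ ^ p) Filter.atTop (nhds 0) := by
      have := (ha.sub_const (g a)).norm.rpow_const (p := p) (Or.inr hp.le)
      rwa [sub_self, norm_zero, Real.zero_rpow hp.ne'] at this
    simpa using (e1.sub e2).sub_const (‖g a‖ ^ p)
  have hDint : Filter.Tendsto (fun n => ∫ a, D n a ∂μ) Filter.atTop (nhds 0) := by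
    rw [Metric.tendsto_atTop]
    intro ε hε
    set η : ℝ := ε / (2 * (K' + 1))
    have hη : 0 < η := by positivity
    have hηK : η * K' ≤ ε / 2 := by
      have : η * (K' + 1) = ε / 2 := by simp only [η]; field_simp
      nlinarith
    obtain ⟨C, hC, hCb⟩ := exists_abs_norm_rpow_sub_le hp hη
    have hDb : ∀ n a, |D n a| ≤ η * ‖f n a - g a‖ ^ p + (C + 1) * ‖g a‖ ^ p := fun n a => by
      have h2 := hCb (g a) (f n a - g a)
      rw [add_sub_cancel] at h2
      calc |D n a| ≤ |‖f n a‖ ^ p - ‖f n a - g a‖ ^ p| + |‖g a‖ ^ p| := abs_sub _ _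
        _ ≤ _ := by
          rw [abs_of_nonneg (by positivity : 0 ≤ ‖g a‖ ^ p)]
          linarith
    -- The excess of `|D n|` over `η ‖f n - g‖^p` is dominated by `(C + 1) ‖g‖^p`, so its integral
    -- tends to zero; the part removed integrates to at most `η K' ≤ ε / 2`.
    set W : ℕ → α → ℝ := fun n a => max (|D n a| - η * ‖f n a - g a‖ ^ p) 0
    have hWi : ∀ n, Integrable (W n) μ := fun n =>
      ((hDi n).abs.sub ((hdi n).const_mul η)).pos_part
    have hWint : Filter.Tendsto (fun n => ∫ a, W n a ∂μ) Filter.atTop (nhds (∫ _, (0 : ℝ) ∂μ)) := by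
      refine tendsto_integral_of_dominated_convergence (fun a => (C + 1) * ‖g a‖ ^ p)
        (fun n => (hWi n).aestronglyMeasurable) (hgi.const_mul _)
        (fun n => Filter.Eventually.of_forall fun a => ?_) ?_
      · rw [Real.norm_of_nonneg (le_max_right _ _)]
        exact max_le (by linarith [hDb n a]) (by positivity)
      · filter_upwards [hDlim] with a ha
        refine squeeze_zero (fun n => le_max_right _ _) (fun n => ?_) (by simpa using ha.abs)
        refine max_le ?_ (abs_nonneg _)
        have : 0 ≤ η * ‖f n a - g a‖ ^ p := by positivity
        linarith
    rw [integral_zero, Metric.tendsto_atTop] at hWint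
    obtain ⟨N, hN⟩ := hWint (ε / 2) (by positivity)
    refine ⟨N, fun n hn => ?_⟩
    have h3 := hN n hn
    rw [Real.dist_0_eq_abs] at h3 ⊢
    have h4 : |∫ a, D n a ∂μ| ≤ ∫ a, W n a ∂μ + η * ∫ a, ‖f n a - g a‖ ^ p ∂μ := by
      rw [← integral_const_mul, ← integral_add (hWi n) ((hdi n).const_mul η), ← Real.norm_eq_abs]
      refine norm_integral_le_of_norm_le ((hWi n).add ((hdi n).const_mul η))
        (Filter.Eventually.of_forall fun a => ?_)
      have := le_max_left (|D n a| - η * ‖f n a - g a‖ ^ p) 0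
      rw [Real.norm_eq_abs]
      simp only [W]
      linarith
    have h5 : η * ∫ a, ‖f n a - g a‖ ^ p ∂μ ≤ η * K' := by
      gcongr
      exact hK' n
    linarith [le_abs_self (∫ a, W n a ∂μ)]
  have := hDint.add_const (∫ a, ‖g a‖ ^ p ∂μ)
  rw [zero_add] at this
  refine this.congr fun n => ?_
  rw [← integral_add (hDi n) hgi, ← integral_sub (hfi n) (hdi n)]
  simp only [D, sub_add_cancel]

/-! ### Weak compactness -/

/-- Sequential Banach–Alaoglu, transferred by the Riesz isometry. That isometry is conjugate-linear,
hence the conjugations. -/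
theorem exists_subseq_tendsto_weakly {E : Type*} [NormedAddCommGroup E] [InnerProductSpace ℂ E]
    [CompleteSpace E] [TopologicalSpace.SeparableSpace E] {f : ℕ → E} {R : ℝ}
    (hf : ∀ n, ‖f n‖ ≤ R) :
    ∃ g : E, ∃ ns : ℕ → ℕ, StrictMono ns ∧ ∀ ℓ : E →L[ℂ] ℂ,
      Filter.Tendsto (fun n => ℓ (f (ns n))) Filter.atTop (nhds (ℓ g)) := by
  have hmem : ∀ n, StrongDual.toWeakDual (InnerProductSpace.toDual ℂ E (f n)) ∈
      WeakDual.toStrongDual ⁻¹' Metric.closedBall (0 : StrongDual ℂ E) R := fun n => by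
    simpa using hf n
  obtain ⟨x, -, ns, hns, hlim⟩ := WeakDual.isSeqCompact_closedBall ℂ E 0 R hmem
  refine ⟨(InnerProductSpace.toDual ℂ E).symm (WeakDual.toStrongDual x), ns, hns, fun ℓ => ?_⟩
  have h := ((WeakDual.eval_continuous ((InnerProductSpace.toDual ℂ E).symm ℓ)).tendsto x).comp hlim
  have h2 := (Complex.continuous_conj.tendsto _).comp h
  convert! h2 using 1
  · funext n
    change _ = (starRingEnd ℂ) (InnerProductSpace.toDual ℂ E (f (ns n)) _)
    rw [InnerProductSpace.toDual_apply_apply, inner_conj_symm, InnerProductSpace.toDual_symm_apply]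
  · congr 1
    have e : x ((InnerProductSpace.toDual ℂ E).symm ℓ) = inner ℂ
        ((InnerProductSpace.toDual ℂ E).symm (WeakDual.toStrongDual x))
        ((InnerProductSpace.toDual ℂ E).symm ℓ) := by
      rw [InnerProductSpace.toDual_symm_apply]
      rfl
    rw [e, inner_conj_symm, InnerProductSpace.toDual_symm_apply]

instance : TopologicalSpace.SeparableSpace L2 := by
  have : Fact ((2 : ENNReal) ≠ ⊤) := ⟨by norm_num⟩
  infer_instance

/-- The product carries the sup norm and is not a Hilbert space, so subsequences are extracted one
component at a time. -/
theorem H12.exists_subseq_tendsto_weakly {u : ℕ → H12} {R : ℝ} (h1 : ∀ n, ‖(u n).fn‖ ≤ R)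
    (h2 : ∀ n, ‖(u n).dx‖ ≤ R) (h3 : ∀ n, ‖(u n).dyy‖ ≤ R) :
    ∃ v : H12, ∃ ns : ℕ → ℕ, StrictMono ns ∧ ∀ ℓ : L2 × L2 × L2 →L[ℂ] ℂ,
      Filter.Tendsto (fun n => ℓ (u (ns n))) Filter.atTop (nhds (ℓ v)) := by
  obtain ⟨a, na, hna, ha⟩ := _root_.exists_subseq_tendsto_weakly h1
  obtain ⟨b, nb, hnb, hb⟩ := _root_.exists_subseq_tendsto_weakly fun n => h2 (na n)
  obtain ⟨c, nc, hnc, hc⟩ := _root_.exists_subseq_tendsto_weakly fun n => h3 (na (nb n))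
  have key : ∀ ℓ : L2 × L2 × L2 →L[ℂ] ℂ, Filter.Tendsto (fun n => ℓ (u (na (nb (nc n)))))
      Filter.atTop (nhds (ℓ (a, b, c))) := by
    intro ℓ
    have hsplit : ∀ T : L2 × L2 × L2, ℓ T =
        ℓ.comp (.inl ℂ L2 (L2 × L2)) T.1 +
        (ℓ.comp ((ContinuousLinearMap.inr ℂ L2 (L2 × L2)).comp (.inl ℂ L2 L2)) T.2.1 +
        ℓ.comp ((ContinuousLinearMap.inr ℂ L2 (L2 × L2)).comp (.inr ℂ L2 L2)) T.2.2) := by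
      intro T
      simp only [ContinuousLinearMap.comp_apply, ContinuousLinearMap.inl_apply,
        ContinuousLinearMap.inr_apply, ← map_add]
      simp
    rw [hsplit (a, b, c)]
    simp_rw [hsplit (u _)]
    exact ((ha _).comp (hnb.comp hnc).tendsto_atTop).add (((hb _).comp hnc.tendsto_atTop).add (hc _))
  -- A closed subspace is weakly closed, by Hahn–Banach separation.
  have hmem : (a, b, c) ∈ testGraph.topologicalClosure := by
    by_contra hnot
    obtain ⟨ℓ, r, hℓ, hr⟩ := RCLike.geometric_hahn_banach_closed_point (𝕜 := ℂ)
      (s := (testGraph.topologicalClosure : Set (L2 × L2 × L2)))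
      (testGraph.topologicalClosure.restrictScalars ℝ).convex
      testGraph.isClosed_topologicalClosure hnot
    have hre := (Complex.continuous_re.tendsto _).comp (key ℓ)
    exact absurd (le_of_tendsto hre (Filter.Eventually.of_forall fun n => (hℓ _ (u _).2).le))
      (not_le.2 hr)
  exact ⟨⟨_, hmem⟩, _, hna.comp (hnb.comp hnc), key⟩

/-- The norm splits along a weakly convergent sequence. -/
theorem tendsto_norm_sq_sub_of_weakly {E : Type*} [NormedAddCommGroup E] [InnerProductSpace ℂ E]
    {f : ℕ → E} {g : E}
    (h : ∀ ℓ : E →L[ℂ] ℂ, Filter.Tendsto (fun n => ℓ (f n)) Filter.atTop (nhds (ℓ g))) :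
    Filter.Tendsto (fun n => ‖f n‖ ^ 2 - ‖f n - g‖ ^ 2) Filter.atTop (nhds (‖g‖ ^ 2)) := by
  have h1 := (Complex.continuous_re.tendsto _).comp (h (innerSL ℂ g))
  have h2 := (h1.const_mul 2).sub_const (‖g‖ ^ 2)
  have e : 2 * (innerSL ℂ g g).re - ‖g‖ ^ 2 = ‖g‖ ^ 2 := by
    have : (innerSL ℂ g g).re = ‖g‖ ^ 2 := by
      simp [inner_self_eq_norm_sq_to_K, ← Complex.ofReal_pow]
    rw [this]
    ring
  rw [e] at h2
  refine h2.congr fun n => ?_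
  have h3 := norm_sub_sq (𝕜 := ℂ) (f n) g
  have h4 : (innerSL ℂ g (f n)).re = RCLike.re (inner ℂ (f n) g) := by
    rw [inner_re_symm]
    rfl
  simp only [Function.comp_apply, h4]
  linarith

namespace H12

/-! ### The Gagliardo–Nirenberg inequality -/

theorem norm_value_le (z : Plane) (u : H12) :
    ‖value z u‖ ≤
      2 * (‖u.dx‖ ^ (1 / 2 : ℝ) * ‖u.dyy‖ ^ (1 / 4 : ℝ) * ‖u.fn‖ ^ (1 / 4 : ℝ)) := by
  refine le_of_pow_le_pow_left₀ (n := 8) (by norm_num) (by positivity)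
    ((norm_value_pow_eight_le z u).trans_eq ?_)
  have h : ∀ (x : ℝ) (k : ℝ) (m : ℕ), 0 ≤ x → k * 8 = m → (x ^ k) ^ 8 = x ^ m := by
    intro x k m hx hk
    rw [← Real.rpow_natCast (x ^ k), ← Real.rpow_mul hx, ← Real.rpow_natCast x, ← hk]
    norm_num
  rw [mul_pow, mul_pow, mul_pow, h _ _ 4 (norm_nonneg _) (by norm_num),
    h _ _ 2 (norm_nonneg _) (by norm_num), h _ _ 2 (norm_nonneg _) (by norm_num)]
  ring

theorem ae_norm_fn_le {u : H12} {R : ℝ} (h : ∀ z, ‖value z u‖ ≤ R) : ∀ᵐ z, ‖u.fn z‖ ≤ R := by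
  filter_upwards [fn_ae_eq_value u] with z hz
  rw [hz]
  exact h z

theorem exists_ae_norm_fn_le (u : H12) : ∃ R : ℝ, 0 ≤ R ∧ ∀ᵐ z, ‖u.fn z‖ ≤ R :=
  ⟨_, by positivity, ae_norm_fn_le fun z => norm_value_le z u⟩

theorem aestronglyMeasurable_norm_rpow (p : ℝ) (u : H12) :
    AEStronglyMeasurable (fun z => ‖u.fn z‖ ^ p) volume :=
  ((Lp.aestronglyMeasurable u.fn).norm.aemeasurable.pow_const p).aestronglyMeasurable

theorem norm_rpow_le {p : ℝ} (hp : 2 < p) {R : ℝ} {w : ℂ} (hw : ‖w‖ ≤ R) :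
    ‖w‖ ^ p ≤ R ^ (p - 2) * ‖w‖ ^ 2 := by
  have e : ‖w‖ ^ p = ‖w‖ ^ (p - 2) * ‖w‖ ^ 2 := by
    rw [← Real.rpow_natCast ‖w‖ 2, ← Real.rpow_add_of_nonneg (norm_nonneg _) (by linarith)
      (by norm_num)]
    norm_num
  rw [e]
  gcongr

variable {p : ℝ}

theorem integrable_norm_rpow (hp : 2 < p) (u : H12) : Integrable fun z => ‖u.fn z‖ ^ p := by
  obtain ⟨R, -, hR⟩ := exists_ae_norm_fn_le u
  refine ((L2.integrable_norm_sq u.fn).const_mul (R ^ (p - 2))).mono'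
    (aestronglyMeasurable_norm_rpow p u) ?_
  filter_upwards [hR] with z hz
  rw [Real.norm_of_nonneg (by positivity)]
  exact norm_rpow_le hp hz

theorem memLp_fn (hp : 2 < p) (u : H12) : MemLp (u.fn : Plane → ℂ) (ENNReal.ofReal p) volume := by
  have hp0 : 0 < p := by linarith
  rw [← integrable_norm_rpow_iff (Lp.aestronglyMeasurable u.fn) (by simpa using hp0) (by simp),
    ENNReal.toReal_ofReal hp0.le]
  exact integrable_norm_rpow hp u

theorem normPow_le_of_bound (hp : 2 < p) {u : H12} {R : ℝ} (h : ∀ z, ‖value z u‖ ≤ R) :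
    u.normPow p ≤ R ^ (p - 2) * ‖u.fn‖ ^ 2 := by
  rw [L2.norm_sq_eq_integral, ← integral_const_mul]
  refine integral_mono_ae (integrable_norm_rpow hp u)
    ((L2.integrable_norm_sq u.fn).const_mul _) ?_
  filter_upwards [ae_norm_fn_le h] with z hz
  exact norm_rpow_le hp hz

theorem normPow_nonneg (p : ℝ) (u : H12) : 0 ≤ u.normPow p := integral_nonneg fun z => by positivity

theorem gnProduct_nonneg (p : ℝ) (u : H12) : 0 ≤ u.gnProduct p := by
  unfold gnProduct
  positivity

/-- The sup bound raised to the power `p - 2`, times `‖u‖₂²`. This constant is not optimal; it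
serves to make `minEnergy` and `gnProduct` positive. -/
theorem normPow_le_gnProduct (hp : 2 < p) (u : H12) :
    u.normPow p ≤ 2 ^ (p - 2) * u.gnProduct p := by
  refine (normPow_le_of_bound hp fun z => norm_value_le z u).trans_eq ?_
  rw [Real.mul_rpow (by norm_num) (by positivity), Real.mul_rpow (by positivity) (by positivity),
    Real.mul_rpow (by positivity) (by positivity), ← Real.rpow_mul (norm_nonneg _),
    ← Real.rpow_mul (norm_nonneg _), ← Real.rpow_mul (norm_nonneg _), gnProduct]
  have e : ‖u.fn‖ ^ ((p + 6) / 4) = ‖u.fn‖ ^ (1 / 4 * (p - 2)) * ‖u.fn‖ ^ 2 := by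
    rw [← Real.rpow_natCast ‖u.fn‖ 2, ← Real.rpow_add_of_nonneg (norm_nonneg _) (by linarith)
      (by norm_num)]
    congr 1
    push_cast
    ring
  rw [e, show (1 / 2 * (p - 2) : ℝ) = (p - 2) / 2 by ring,
    show (1 / 4 * (p - 2) : ℝ) = (p - 2) / 4 by ring]
  ring

theorem normPow_eq_zero_iff (hp : 2 < p) {u : H12} : u.normPow p = 0 ↔ u = 0 := by
  have hp0 : p ≠ 0 := by linarith
  constructor
  · intro h
    rw [normPow, integral_eq_zero_iff_of_nonneg (fun z => by positivity)
      (integrable_norm_rpow hp u)] at h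
    refine fn_injective (Lp.ext ?_)
    refine Filter.EventuallyEq.trans ?_ (Lp.coeFn_zero ℂ 2 (volume : Measure Plane)).symm
    filter_upwards [h] with z hz
    exact norm_eq_zero.1 ((Real.rpow_eq_zero (norm_nonneg _) hp0).1 hz)
  · rintro rfl
    have h := Lp.coeFn_zero ℂ 2 (volume : Measure Plane)
    refine integral_eq_zero_of_ae ?_
    filter_upwards [h] with z hz
    change ‖(0 : L2) z‖ ^ p = 0
    rw [hz]
    simp [hp0]

theorem normPow_pos (hp : 2 < p) {u : H12} (hu : u ≠ 0) : 0 < u.normPow p :=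
  (normPow_nonneg p u).lt_of_ne fun h => hu ((normPow_eq_zero_iff hp).1 h.symm)

theorem gnProduct_pos (hp : 2 < p) {u : H12} (hu : u ≠ 0) : 0 < u.gnProduct p :=
  pos_of_mul_pos_right ((normPow_pos hp hu).trans_le (normPow_le_gnProduct hp u)) (by positivity)

theorem normPow_smul (p : ℝ) (c : ℂ) (u : H12) : (c • u).normPow p = ‖c‖ ^ p * u.normPow p := by
  unfold normPow
  rw [← integral_const_mul]
  refine integral_congr_ae ?_
  filter_upwards [Lp.coeFn_smul c u.fn] with z hz
  change ‖(c • u.fn) z‖ ^ p = _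
  rw [hz, Pi.smul_apply, norm_smul, Real.mul_rpow (norm_nonneg _) (norm_nonneg _)]

/-! ### The quadratic part of the energy -/

/-- The quadratic form `‖∂ₓu‖₂² + ‖∂_{yy}u‖₂² + ‖u‖₂²`. -/
noncomputable def energy (u : H12) : ℝ := ‖u.dx‖ ^ 2 + ‖u.dyy‖ ^ 2 + ‖u.fn‖ ^ 2

theorem energy_nonneg (u : H12) : 0 ≤ u.energy := by
  unfold energy
  positivity

theorem energy_smul (c : ℂ) (u : H12) : (c • u).energy = ‖c‖ ^ 2 * u.energy := by
  change ‖c • u.dx‖ ^ 2 + ‖c • u.dyy‖ ^ 2 + ‖c • u.fn‖ ^ 2 = _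
  rw [norm_smul, norm_smul, norm_smul, energy]
  ring

theorem norm_fn_le (u : H12) : ‖u.fn‖ ≤ √u.energy :=
  Real.le_sqrt_of_sq_le (by unfold energy; nlinarith [sq_nonneg ‖u.dx‖, sq_nonneg ‖u.dyy‖])

theorem norm_dx_le (u : H12) : ‖u.dx‖ ≤ √u.energy :=
  Real.le_sqrt_of_sq_le (by unfold energy; nlinarith [sq_nonneg ‖u.fn‖, sq_nonneg ‖u.dyy‖])

theorem norm_dyy_le (u : H12) : ‖u.dyy‖ ≤ √u.energy :=
  Real.le_sqrt_of_sq_le (by unfold energy; nlinarith [sq_nonneg ‖u.dx‖, sq_nonneg ‖u.fn‖])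

/-- The three exponents add up to `p`. -/
theorem gnProduct_le_energy (hp : 2 < p) (u : H12) : u.gnProduct p ≤ √u.energy ^ p := by
  have e : √u.energy ^ p =
      √u.energy ^ ((p - 2) / 2) * √u.energy ^ ((p - 2) / 4) * √u.energy ^ ((p + 6) / 4) := by
    rw [← Real.rpow_add_of_nonneg (by positivity) (by linarith) (by linarith),
      ← Real.rpow_add_of_nonneg (by positivity) (by linarith) (by linarith)]
    congr 1
    ring
  have h1 := norm_fn_le u
  have h2 := norm_dx_le u
  have h3 := norm_dyy_le u
  rw [e, gnProduct]
  gcongr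

theorem energy_translate (a : Plane) (u : H12) : (translate a u).energy = u.energy := by
  rw [energy, norm_sq_dx_translate, norm_sq_dyy_translate, norm_sq_fn_translate, energy]

/-! ### Existence of a minimiser of `energy` on the sphere `normPow p = 1` -/

theorem exists_ne_zero : ∃ u : H12, u ≠ 0 := by
  let b : ContDiffBump (0 : Plane) := ⟨1, 2, by norm_num, by norm_num⟩
  have hφ : IsTest (fun z => ((b z : ℝ) : ℂ)) :=
    ⟨Complex.ofRealCLM.contDiff.comp b.contDiff,
      b.hasCompactSupport.comp_left (g := fun t : ℝ => (t : ℂ)) (by simp)⟩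
  refine ⟨ofTest hφ, fun h => ?_⟩
  have h0 := value_ofTest hφ 0
  rw [h, map_zero, b.one_of_mem_closedBall (by simp [b])] at h0
  simp at h0

/-- The infimum of `energy` on the sphere `normPow p = 1`. -/
noncomputable def minEnergy (p : ℝ) : ℝ := sInf (energy '' {u : H12 | u.normPow p = 1})

theorem exists_smul_normPow_eq_one (hp : 2 < p) {u : H12} (hu : u ≠ 0) :
    ∃ c : ℂ, (c • u).normPow p = 1 ∧ ‖c‖ ^ 2 * u.normPow p ^ (2 / p) = 1 := by
  have hP := normPow_pos hp hu
  have hp0 : p ≠ 0 := by linarith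
  have hn : ‖((u.normPow p ^ (-1 / p) : ℝ) : ℂ)‖ = u.normPow p ^ (-1 / p) := by
    rw [Complex.norm_real, Real.norm_of_nonneg (by positivity)]
  refine ⟨((u.normPow p ^ (-1 / p) : ℝ) : ℂ), ?_, ?_⟩
  · rw [normPow_smul, hn, ← Real.rpow_mul hP.le, div_mul_cancel₀ _ hp0, Real.rpow_neg_one,
      inv_mul_cancel₀ hP.ne']
  · rw [hn, ← Real.rpow_natCast, ← Real.rpow_mul hP.le, ← Real.rpow_add hP]
    rw [show (-1 / p * ((2 : ℕ) : ℝ) + 2 / p) = 0 by push_cast; ring, Real.rpow_zero]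

theorem nonempty_sphere (hp : 2 < p) : (energy '' {u : H12 | u.normPow p = 1}).Nonempty := by
  obtain ⟨u, hu⟩ := exists_ne_zero
  obtain ⟨c, hc, -⟩ := exists_smul_normPow_eq_one hp hu
  exact ⟨_, _, hc, rfl⟩

theorem bddBelow_sphere (p : ℝ) : BddBelow (energy '' {u : H12 | u.normPow p = 1}) :=
  ⟨0, by rintro _ ⟨u, -, rfl⟩; exact energy_nonneg u⟩

theorem minEnergy_pos (hp : 2 < p) : 0 < minEnergy p := by
  have hp0 : p ≠ 0 := by linarith
  set c : ℝ := (2 ^ (p - 2))⁻¹ ^ (1 / p)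
  have hc : 0 < c := by positivity
  refine (by positivity : 0 < c ^ 2).trans_le (le_csInf (nonempty_sphere hp) ?_)
  rintro _ ⟨u, hu, rfl⟩
  have h1 := (normPow_le_gnProduct hp u).trans
    (mul_le_mul_of_nonneg_left (gnProduct_le_energy hp u) (by positivity))
  rw [show u.normPow p = 1 from hu] at h1
  have h2 : c ≤ √u.energy := by
    refine le_of_le_of_eq (Real.rpow_le_rpow (by positivity)
      ((inv_le_iff_one_le_mul₀' (by positivity)).2 h1) (by positivity)) ?_
    rw [← Real.rpow_mul (by positivity), mul_one_div_cancel hp0, Real.rpow_one]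
  calc c ^ 2 ≤ √u.energy ^ 2 := by gcongr
    _ = u.energy := Real.sq_sqrt (energy_nonneg u)

theorem minEnergy_mul_le (hp : 2 < p) (u : H12) :
    minEnergy p * u.normPow p ^ (2 / p) ≤ u.energy := by
  by_cases hu : u = 0
  · rw [(normPow_eq_zero_iff hp).2 hu, Real.zero_rpow (by positivity), mul_zero]
    exact energy_nonneg u
  · obtain ⟨c, hc, hc2⟩ := exists_smul_normPow_eq_one hp hu
    have h : minEnergy p ≤ (c • u).energy := csInf_le (bddBelow_sphere p) ⟨_, hc, rfl⟩
    rw [energy_smul] at h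
    have hP := normPow_pos hp hu
    calc minEnergy p * u.normPow p ^ (2 / p) ≤ ‖c‖ ^ 2 * u.energy * u.normPow p ^ (2 / p) := by
          gcongr
      _ = u.energy * (‖c‖ ^ 2 * u.normPow p ^ (2 / p)) := by ring
      _ = u.energy := by rw [hc2, mul_one]

/-- A function with small sup norm and bounded `L²` norm has small `Lᵖ` norm. -/
theorem exists_lt_norm_value (hp : 2 < p) {u : H12} (hu : u.normPow p = 1) {c : ℝ}
    (hc : c ^ (p - 2) * u.energy < 1) : ∃ z, c < ‖value z u‖ := by
  by_contra! h
  have hc0 : 0 ≤ c := (norm_nonneg _).trans (h 0)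
  have h1 := normPow_le_of_bound hp h
  have h2 : ‖u.fn‖ ^ 2 ≤ u.energy := by
    unfold energy
    nlinarith [sq_nonneg ‖u.dx‖, sq_nonneg ‖u.dyy‖]
  have h3 : c ^ (p - 2) * ‖u.fn‖ ^ 2 ≤ c ^ (p - 2) * u.energy := by gcongr
  linarith

/-- A translated minimising sequence has a nonzero weak limit `w`. Both `energy` and `normPow` split
between `w` and the remainder, and splitting the mass as `a + (1 - a)` with `0 < a < 1` would cost
strictly more than `S`. -/
theorem exists_minimizer (hp : 2 < p) :
    ∃ v : H12, v.normPow p = 1 ∧ v.energy = minEnergy p := by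
  set S := minEnergy p with hS
  have hS0 : 0 < S := minEnergy_pos hp
  have hp0 : 0 < p := by linarith
  have hex : ∀ n : ℕ, ∃ u : H12, u.normPow p = 1 ∧ u.energy < S + 1 / ((n : ℝ) + 1) := fun n => by
    obtain ⟨_, ⟨u, hu, rfl⟩, h⟩ := exists_lt_of_csInf_lt (nonempty_sphere hp)
      (lt_add_of_pos_right S (Nat.one_div_pos_of_nat (α := ℝ) (n := n)))
    exact ⟨u, hu, h⟩
  choose u hu1 huS using hex
  have huS1 : ∀ n, (u n).energy ≤ S + 1 := fun n => by
    have : 1 / ((n : ℝ) + 1) ≤ 1 := by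
      rw [div_le_one (by positivity)]
      linarith [(Nat.cast_nonneg n : (0 : ℝ) ≤ n)]
    linarith [huS n]
  -- Chosen so that `c^{p-2} (S + 1) = 1/2`, where `S + 1` bounds the energies.
  set c : ℝ := (1 / (2 * (S + 1))) ^ (1 / (p - 2))
  have hc0 : 0 < c := by positivity
  have hcp : c ^ (p - 2) = 1 / (2 * (S + 1)) := by
    rw [← Real.rpow_mul (by positivity), one_div_mul_cancel (by linarith), Real.rpow_one]
  have hval : ∀ n, ∃ z, c < ‖value z (u n)‖ := fun n => by
    refine exists_lt_norm_value hp (hu1 n) ?_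
    rw [hcp]
    calc 1 / (2 * (S + 1)) * (u n).energy ≤ 1 / (2 * (S + 1)) * (S + 1) := by
          gcongr
          exact huS1 n
      _ = 1 / 2 := by field_simp
      _ < 1 := by norm_num
  choose z hz using hval
  set v : ℕ → H12 := fun n => translate (z n) (u n)
  have hvE : ∀ n, (v n).energy = (u n).energy := fun n => energy_translate _ _
  have hvP : ∀ n, (v n).normPow p = 1 := fun n => (normPow_translate p _ _).trans (hu1 n)
  have hsq : ∀ n, √(v n).energy ≤ √(S + 1) := fun n =>
    Real.sqrt_le_sqrt ((hvE n).le.trans (huS1 n))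
  obtain ⟨w, ns, hns, hw⟩ := exists_subseq_tendsto_weakly (u := v)
    (fun n => (norm_fn_le _).trans (hsq n)) (fun n => (norm_dx_le _).trans (hsq n))
    (fun n => (norm_dyy_le _).trans (hsq n))
  -- The translations put a value of modulus above `c` at the origin, and evaluation there passes to
  -- the weak limit.
  have hw0 : w ≠ 0 := by
    rintro rfl
    have h := ge_of_tendsto (hw evalZero).norm
      (Filter.Eventually.of_forall fun n => (hz (ns n)).le)
    rw [show ((0 : H12) : L2 × L2 × L2) = 0 from rfl, map_zero, norm_zero] at h
    linarith
  -- Evaluation at `y` is also a continuous functional of the triple, so no local compactness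
  -- theorem is needed.
  have hpt : ∀ y, Filter.Tendsto (fun n => value y (v (ns n))) Filter.atTop (nhds (value y w)) :=
    fun y => hw (evalZero.comp (rescaleTriple one_pos one_pos y))
  have hae : ∀ᵐ y, Filter.Tendsto (fun n => (v (ns n)).fn y) Filter.atTop (nhds (w.fn y)) := by
    filter_upwards [fn_ae_eq_value w, ae_all_iff.2 fun n => fn_ae_eq_value (v (ns n))] with y h1 h2
    rw [h1]
    simpa only [h2] using hpt y
  have hBL := tendsto_integral_norm_rpow_sub hp0
    (fun n => Lp.aestronglyMeasurable (v (ns n)).fn) (Lp.aestronglyMeasurable w.fn)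
    (fun n => integrable_norm_rpow hp (v (ns n))) (integrable_norm_rpow hp w)
    (fun n => (hvP (ns n)).le) hae
  have hP : Filter.Tendsto (fun n => (v (ns n) - w).normPow p) Filter.atTop
      (nhds (1 - w.normPow p)) := by
    refine (hBL.const_sub 1).congr fun n => ?_
    have h1 : ∫ y, ‖(v (ns n)).fn y - w.fn y‖ ^ p = (v (ns n) - w).normPow p := by
      refine integral_congr_ae ?_
      filter_upwards [Lp.coeFn_sub (v (ns n)).fn w.fn] with y hy
      change _ = ‖((v (ns n)).fn - w.fn) y‖ ^ p
      rw [hy]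
      rfl
    have h2 : ∫ y, ‖(v (ns n)).fn y‖ ^ p = 1 := hvP (ns n)
    rw [h1, h2]
    ring
  have hE1 : Filter.Tendsto (fun n => (v (ns n)).energy) Filter.atTop (nhds S) := by
    have h1 : Filter.Tendsto (fun n : ℕ => S + 1 / ((ns n : ℝ) + 1)) Filter.atTop (nhds S) := by
      simpa using ((tendsto_one_div_add_atTop_nhds_zero_nat (𝕜 := ℝ)).comp
        hns.tendsto_atTop).const_add S
    refine tendsto_of_tendsto_of_tendsto_of_le_of_le tendsto_const_nhds h1 (fun n => ?_) fun n => ?_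
    · exact csInf_le (bddBelow_sphere p) ⟨_, hvP (ns n), rfl⟩
    · exact (hvE _).trans_le (huS _).le
  have hE : Filter.Tendsto (fun n => (v (ns n) - w).energy) Filter.atTop
      (nhds (S - w.energy)) := by
    have h1 := tendsto_norm_sq_sub_of_weakly (f := fun n => (v (ns n)).fn) (g := w.fn)
      fun ℓ => hw (ℓ.comp (.fst ℂ L2 (L2 × L2)))
    have h2 := tendsto_norm_sq_sub_of_weakly (f := fun n => (v (ns n)).dx) (g := w.dx)
      fun ℓ => hw (ℓ.comp ((ContinuousLinearMap.fst ℂ L2 L2).comp (.snd ℂ L2 (L2 × L2))))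
    have h3 := tendsto_norm_sq_sub_of_weakly (f := fun n => (v (ns n)).dyy) (g := w.dyy)
      fun ℓ => hw (ℓ.comp ((ContinuousLinearMap.snd ℂ L2 L2).comp (.snd ℂ L2 (L2 × L2))))
    refine (hE1.sub ((h2.add h3).add h1)).congr fun n => ?_
    change (v (ns n)).energy - _ = ‖(v (ns n)).dx - w.dx‖ ^ 2 + ‖(v (ns n)).dyy - w.dyy‖ ^ 2 +
      ‖(v (ns n)).fn - w.fn‖ ^ 2
    unfold energy
    ring
  set a := w.normPow p
  have ha0 : 0 < a := normPow_pos hp hw0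
  have ha1 : 0 ≤ 1 - a := ge_of_tendsto hP (Filter.Eventually.of_forall fun n => normPow_nonneg p _)
  have hθ : 0 < 2 / p := by positivity
  have hθ1 : 2 / p < 1 := by rwa [div_lt_one hp0]
  -- The limit of the variational inequality for the remainders; adding the one for `w` gives
  -- `hsum`.
  have hlim : S * (1 - a) ^ (2 / p) ≤ S - w.energy :=
    le_of_tendsto_of_tendsto ((hP.rpow_const (Or.inr hθ.le)).const_mul S) hE
      (Filter.Eventually.of_forall fun n => minEnergy_mul_le hp _)
  have hwE := minEnergy_mul_le hp w
  have hsum : a ^ (2 / p) + (1 - a) ^ (2 / p) ≤ 1 := by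
    have h : S * (a ^ (2 / p) + (1 - a) ^ (2 / p)) ≤ S * 1 := by linarith
    exact le_of_mul_le_mul_left h hS0
  have ha : a = 1 := by
    by_contra hne
    have hlt : a < 1 := lt_of_le_of_ne (by linarith) hne
    have h1 : a < a ^ (2 / p) := by
      simpa using Real.rpow_lt_rpow_of_exponent_gt ha0 hlt hθ1
    have h2 : 1 - a ≤ (1 - a) ^ (2 / p) := by
      have h0 : 0 < 1 - a := by linarith
      have h3 : 1 - a ≤ 1 := by linarith
      simpa using Real.rpow_le_rpow_of_exponent_ge h0 h3 hθ1.le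
    linarith
  refine ⟨w, ha, le_antisymm ?_ ?_⟩
  · have : 0 ≤ S * (1 - a) ^ (2 / p) := by positivity
    linarith
  · rw [show w.normPow p = 1 from ha, Real.one_rpow, mul_one] at hwE
    exact hwE

end H12

/-! ### Weak solutions -/

theorem IsTest.conj {φ : Plane → ℂ} (hφ : IsTest φ) : IsTest fun z => (starRingEnd ℂ) (φ z) :=
  ⟨Complex.conjCLE.contDiff.comp hφ.1, hφ.2.comp_left (g := starRingEnd ℂ) (map_zero _)⟩

theorem fderiv_conj {φ : Plane → ℂ} (hφ : IsTest φ) (z v : Plane) :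
    fderiv ℝ (fun z => (starRingEnd ℂ) (φ z)) z v = (starRingEnd ℂ) (fderiv ℝ φ z v) := by
  have h : HasFDerivAt (fun z => (starRingEnd ℂ) (φ z))
      ((Complex.conjCLE : ℂ →L[ℝ] ℂ).comp (fderiv ℝ φ z)) z :=
    Complex.conjCLE.hasFDerivAt.comp z (hφ.differentiable z).hasFDerivAt
  rw [h.fderiv]
  rfl

theorem dX_conj {φ : Plane → ℂ} (hφ : IsTest φ) :
    dX (fun z => (starRingEnd ℂ) (φ z)) = fun z => (starRingEnd ℂ) (dX φ z) :=
  funext fun z => fderiv_conj hφ z _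

theorem dY_conj {φ : Plane → ℂ} (hφ : IsTest φ) :
    dY (fun z => (starRingEnd ℂ) (φ z)) = fun z => (starRingEnd ℂ) (dY φ z) :=
  funext fun z => fderiv_conj hφ z _

theorem L2.inner_eq_integral_mul {f g : L2} {ψ : Plane → ℂ}
    (h : (g : Plane → ℂ) =ᵐ[volume] fun z => (starRingEnd ℂ) (ψ z)) :
    inner ℂ g f = ∫ z, f z * ψ z := by
  rw [L2.inner_def]
  refine integral_congr_ae ?_
  filter_upwards [h] with z hz
  simp [hz]

namespace H12

variable {p : ℝ}

/-- Because `u` is bounded, the nonlinearity is dominated by a multiple of `u`. -/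
theorem memLp_nonlinearity (hp : 2 < p) (u : H12) :
    MemLp (fun z => ((‖u.fn z‖ ^ (p - 2) : ℝ) : ℂ) * u.fn z) 2 volume := by
  obtain ⟨R, -, hR⟩ := exists_ae_norm_fn_le u
  refine (Lp.memLp u.fn).of_le_mul (c := R ^ (p - 2)) ?_ ?_
  · exact (Complex.continuous_ofReal.comp_aestronglyMeasurable
      (aestronglyMeasurable_norm_rpow (p - 2) u)).mul (Lp.aestronglyMeasurable u.fn)
  · filter_upwards [hR] with z hz
    rw [norm_mul, Complex.norm_real, Real.norm_of_nonneg (by positivity)]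
    gcongr

/-- The nonlinearity `|u|^{p-2} u` as an element of `L²`. -/
noncomputable def nonlinearity (hp : 2 < p) (u : H12) : L2 := (memLp_nonlinearity hp u).toLp _

theorem coeFn_nonlinearity (hp : 2 < p) (u : H12) : (nonlinearity hp u : Plane → ℂ) =ᵐ[volume]
    fun z => ((‖u.fn z‖ ^ (p - 2) : ℝ) : ℂ) * u.fn z :=
  (memLp_nonlinearity hp u).coeFn_toLp

/-- The sesquilinear form of `energy`. -/
noncomputable def energyForm (w u : H12) : ℂ :=
  inner ℂ w.dx u.dx + inner ℂ w.dyy u.dyy + inner ℂ w.fn u.fn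

theorem energyForm_self (u : H12) : energyForm u u = (u.energy : ℂ) := by
  unfold energyForm energy
  rw [inner_self_eq_norm_sq_to_K, inner_self_eq_norm_sq_to_K, inner_self_eq_norm_sq_to_K]
  push_cast
  rfl

theorem energyForm_smul_left (c : ℂ) (w u : H12) :
    energyForm (c • w) u = (starRingEnd ℂ) c * energyForm w u := by
  change inner ℂ (c • w.dx) u.dx + inner ℂ (c • w.dyy) u.dyy + inner ℂ (c • w.fn) u.fn = _
  rw [inner_smul_left, inner_smul_left, inner_smul_left, energyForm]
  ring

theorem inner_fn_nonlinearity_self (hp : 2 < p) (u : H12) :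
    inner ℂ u.fn (nonlinearity hp u) = (u.normPow p : ℂ) := by
  rw [L2.inner_def, normPow, ← integral_complex_ofReal]
  refine integral_congr_ae ?_
  filter_upwards [coeFn_nonlinearity hp u] with z hz
  have e : ‖u.fn z‖ ^ p = ‖u.fn z‖ ^ (p - 2) * ‖u.fn z‖ ^ 2 := by
    rw [← Real.rpow_natCast ‖u.fn z‖ 2, ← Real.rpow_add_of_nonneg (norm_nonneg _) (by linarith)
      (by norm_num)]
    norm_num
  rw [hz, e, RCLike.inner_apply, mul_assoc, Complex.mul_conj, Complex.normSq_eq_norm_sq]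
  push_cast
  ring

/-- The weak formulation pairs bilinearly, so test functions are conjugated to obtain inner
products. -/
theorem isSolution_iff_ofTest (hp : 2 < p) (W : H12) : IsSolution p W ↔
    ∀ (φ : Plane → ℂ) (hφ : IsTest φ),
      energyForm (ofTest hφ.conj) W = inner ℂ (ofTest hφ.conj).fn (nonlinearity hp W) := by
  refine forall_congr' fun φ => forall_congr' fun hφ => ?_
  have h1 : inner ℂ (ofTest hφ.conj).dx W.dx = ∫ z, W.dx z * _root_.dX φ z :=
    L2.inner_eq_integral_mul (by rw [← dX_conj hφ]; exact dx_ofTest hφ.conj)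
  have h2 : inner ℂ (ofTest hφ.conj).dyy W.dyy = ∫ z, W.dyy z * _root_.dY (_root_.dY φ) z :=
    L2.inner_eq_integral_mul (by
      rw [← dY_conj hφ.dY, ← dY_conj hφ]
      exact dyy_ofTest hφ.conj)
  have h3 : inner ℂ (ofTest hφ.conj).fn W.fn = ∫ z, W.fn z * φ z :=
    L2.inner_eq_integral_mul (fn_ofTest hφ.conj)
  have h4 : inner ℂ (ofTest hφ.conj).fn (nonlinearity hp W) =
      ∫ z, ((‖W.fn z‖ ^ (p - 2) : ℝ) : ℂ) * W.fn z * φ z := by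
    rw [L2.inner_eq_integral_mul (fn_ofTest hφ.conj)]
    refine integral_congr_ae ?_
    filter_upwards [coeFn_nonlinearity hp W] with z hz
    rw [hz]
  rw [energyForm, h1, h2, h3, h4]

/-- Both sides are continuous in `w` and test functions are dense. In particular a solution may be
tested against itself. -/
theorem isSolution_iff (hp : 2 < p) (W : H12) : IsSolution p W ↔
    ∀ w : H12, energyForm w W = inner ℂ w.fn (nonlinearity hp W) := by
  rw [isSolution_iff_ofTest hp]
  refine ⟨fun h w => ?_, fun h φ hφ => h _⟩
  refine closed_induction (Q := fun w => energyForm w W = inner ℂ w.fn (nonlinearity hp W))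
    (isClosed_eq ?_ ?_) (fun φ hφ => ?_) w
  · exact ((continuous_dx.inner continuous_const).add
      (continuous_dyy.inner continuous_const)).add (continuous_fn.inner continuous_const)
  · exact continuous_fn.inner continuous_const
  · simpa using h _ hφ.conj

theorem IsSolution.energy_eq_normPow (hp : 2 < p) {W : H12} (h : IsSolution p W) :
    W.energy = W.normPow p := by
  have := (isSolution_iff hp W).1 h W
  rw [energyForm_self, inner_fn_nonlinearity_self] at this
  exact_mod_cast this

/-! ### The Euler–Lagrange equation -/

theorem rpow_add_mul_le {p x a : ℝ} (hp : 1 ≤ p) (ha : 0 < a) (hx : 0 ≤ x) :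
    a ^ p + p * a ^ (p - 1) * (x - a) ≤ x ^ p := by
  have h := one_add_mul_self_le_rpow_one_add (s := (x - a) / a)
    (by rw [le_div_iff₀ ha]; linarith) hp
  have e : 1 + (x - a) / a = x / a := by field_simp; ring
  rw [e, Real.div_rpow hx ha.le, le_div_iff₀ (by positivity)] at h
  rw [Real.rpow_sub_one ha.ne']
  calc a ^ p + p * (a ^ p / a) * (x - a) = (1 + p * ((x - a) / a)) * a ^ p := by ring
    _ ≤ x ^ p := h

/-- The convex function `‖·‖^p` lies above its tangent at `a`: Bernoulli's inequality in the
modulus, then Cauchy–Schwarz. -/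
theorem norm_rpow_add_le {p : ℝ} (hp : 2 < p) (a b : ℂ) :
    ‖a‖ ^ p + p * (‖a‖ ^ (p - 2) * ((starRingEnd ℂ) b * a).re) ≤ ‖a + b‖ ^ p := by
  by_cases ha : a = 0
  · rw [ha, norm_zero, Real.zero_rpow (by linarith), Real.zero_rpow (by linarith)]
    simp only [zero_mul, mul_zero, zero_add]
    positivity
  · have ha0 : 0 < ‖a‖ := norm_pos_iff.2 ha
    refine le_trans ?_ (rpow_add_mul_le (by linarith) ha0 (norm_nonneg (a + b)))
    have h1 : ‖a‖ ^ 2 + ((starRingEnd ℂ) b * a).re ≤ ‖a‖ * ‖a + b‖ := by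
      have h2 := (Complex.re_le_norm ((starRingEnd ℂ) (a + b) * a))
      rw [norm_mul, RCLike.norm_conj, map_add, add_mul, Complex.add_re, ← Complex.normSq_eq_conj_mul_self,
        Complex.ofReal_re, Complex.normSq_eq_norm_sq, mul_comm ‖a + b‖] at h2
      exact h2
    have e : ‖a‖ ^ (p - 1) = ‖a‖ ^ (p - 2) * ‖a‖ := by
      rw [← Real.rpow_add_one ha0.ne']
      congr 1
      ring
    rw [e]
    have h3 : ‖a‖ ^ (p - 2) * ((starRingEnd ℂ) b * a).re ≤
        ‖a‖ ^ (p - 2) * (‖a‖ * (‖a + b‖ - ‖a‖)) := by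
      gcongr
      linarith
    have h4 : p * (‖a‖ ^ (p - 2) * ((starRingEnd ℂ) b * a).re) ≤
        p * (‖a‖ ^ (p - 2) * (‖a‖ * (‖a + b‖ - ‖a‖))) :=
      mul_le_mul_of_nonneg_left h3 (by linarith)
    linarith

theorem normPow_add_le (hp : 2 < p) (u w : H12) :
    u.normPow p + p * (inner ℂ w.fn (nonlinearity hp u)).re ≤ (u + w).normPow p := by
  have hI : Integrable (fun z => (inner ℂ (w.fn z) (nonlinearity hp u z) : ℂ)) volume :=
    L2.integrable_inner w.fn (nonlinearity hp u)
  have hre : (inner ℂ w.fn (nonlinearity hp u)).re =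
      ∫ z, (inner ℂ (w.fn z) (nonlinearity hp u z)).re := by
    rw [L2.inner_def]
    exact (integral_re hI).symm
  have hIre : Integrable (fun z => (inner ℂ (w.fn z) (nonlinearity hp u z) : ℂ).re) volume := hI.re
  rw [hre, ← integral_const_mul, normPow,
    ← integral_add (integrable_norm_rpow hp u) (hIre.const_mul p)]
  refine integral_mono_ae ((integrable_norm_rpow hp u).add (hIre.const_mul p))
    (integrable_norm_rpow hp (u + w)) ?_
  filter_upwards [coeFn_nonlinearity hp u, Lp.coeFn_add u.fn w.fn] with z h1 h2
  have h3 : (u + w).fn z = u.fn z + w.fn z := h2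
  rw [h3]
  refine le_of_eq_of_le ?_ (norm_rpow_add_le hp (u.fn z) (w.fn z))
  simp only [h1, RCLike.inner_apply]
  congr 2
  rw [mul_assoc, Complex.re_ofReal_mul, mul_comm (u.fn z)]

theorem energy_add_smul (u w : H12) (t : ℝ) :
    (u + (t : ℂ) • w).energy = u.energy + 2 * t * (energyForm w u).re + t ^ 2 * w.energy := by
  have key : ∀ f g : L2, ‖f + (t : ℂ) • g‖ ^ 2 =
      ‖f‖ ^ 2 + 2 * t * (inner ℂ g f).re + t ^ 2 * ‖g‖ ^ 2 := fun f g => by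
    have h := norm_add_sq (𝕜 := ℂ) f ((t : ℂ) • g)
    rw [h, norm_smul, mul_pow, Complex.norm_real, Real.norm_eq_abs, sq_abs, inner_smul_right,
      RCLike.re_eq_complex_re, Complex.re_ofReal_mul]
    have : (inner ℂ f g).re = (inner ℂ g f).re := inner_re_symm (𝕜 := ℂ) f g
    rw [this]
    ring
  change ‖u.dx + (t : ℂ) • w.dx‖ ^ 2 + ‖u.dyy + (t : ℂ) • w.dyy‖ ^ 2 +
    ‖u.fn + (t : ℂ) • w.fn‖ ^ 2 = _
  rw [key, key, key, energy, energy, energyForm, Complex.add_re, Complex.add_re]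
  ring

/-- A minimiser of `energy / normPow^{2/p}`, suitably normalised, solves the equation. -/
theorem isSolution_of_minimizer (hp : 2 < p) {u : H12} (hu : u ≠ 0)
    (hmin : u.energy = minEnergy p * u.normPow p ^ (2 / p)) (hN : u.energy = u.normPow p) :
    IsSolution p u := by
  have hp0 : p ≠ 0 := by linarith
  have hP := normPow_pos hp hu
  have hre : ∀ w : H12, (energyForm w u).re = (inner ℂ w.fn (nonlinearity hp u)).re := by
    intro w
    set L := (energyForm w u).re
    set R := (inner ℂ w.fn (nonlinearity hp u)).re
    -- `normPow (u + t w)` is replaced by its tangent line, a lower bound by convexity. Thus `h ≥ 0`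
    -- near `0` and `h 0 = 0`, and `normPow` itself need not be differentiated.
    set h : ℝ → ℝ := fun t => u.energy + 2 * t * L + t ^ 2 * w.energy -
      minEnergy p * (u.normPow p + p * (t * R)) ^ (2 / p)
    have hlin : HasDerivAt (fun t : ℝ => u.normPow p + p * (t * R)) (p * R) 0 := by
      simpa using (((hasDerivAt_id (0 : ℝ)).mul_const R).const_mul p).const_add (u.normPow p)
    have hd : HasDerivAt h (2 * L - minEnergy p * (p * R * (2 / p) * u.normPow p ^ (2 / p - 1))) 0 := by
      have h1 : HasDerivAt (fun t : ℝ => u.energy + 2 * t * L + t ^ 2 * w.energy) (2 * L) 0 := by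
        have := ((((hasDerivAt_id (0 : ℝ)).const_mul 2).mul_const L).const_add u.energy).add
          (((hasDerivAt_id (0 : ℝ)).pow 2).mul_const w.energy)
        refine HasDerivAt.congr_deriv this ?_
        simp
      have h2 := (hlin.rpow_const (p := 2 / p) (Or.inl (by simpa using hP.ne'))).const_mul
        (minEnergy p)
      simp only [zero_mul, mul_zero, add_zero] at h2
      exact h1.sub h2
    have hloc : IsLocalMin h 0 := by
      have hpos : ∀ᶠ t in nhds (0 : ℝ), 0 < u.normPow p + p * (t * R) :=
        hlin.continuousAt.eventually_const_lt (by simpa using hP)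
      filter_upwards [hpos] with t ht
      have e0 : h 0 = 0 := by
        simp only [h]
        norm_num
        linarith
      rw [e0]
      have h1 := minEnergy_mul_le hp (u + (t : ℂ) • w)
      rw [energy_add_smul] at h1
      have h2 := normPow_add_le hp u ((t : ℂ) • w)
      have h3 : (inner ℂ ((t : ℂ) • w).fn (nonlinearity hp u)).re = t * R := by
        change (inner ℂ ((t : ℂ) • w.fn) (nonlinearity hp u)).re = _
        rw [inner_smul_left, Complex.conj_ofReal, Complex.re_ofReal_mul]
      rw [h3] at h2
      have h4 : (u.normPow p + p * (t * R)) ^ (2 / p) ≤ (u + (t : ℂ) • w).normPow p ^ (2 / p) :=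
        Real.rpow_le_rpow ht.le h2 (by positivity)
      have h5 := mul_le_mul_of_nonneg_left h4 (minEnergy_pos hp).le
      simp only [h]
      linarith
    have h0 := hloc.hasDerivAt_eq_zero hd
    have hS : minEnergy p * u.normPow p ^ (2 / p - 1) = 1 := by
      rw [Real.rpow_sub_one hP.ne', ← mul_div_assoc, ← hmin, hN, div_self hP.ne']
    have e : minEnergy p * (p * R * (2 / p) * u.normPow p ^ (2 / p - 1)) =
        2 * R * (minEnergy p * u.normPow p ^ (2 / p - 1)) := by
      field_simp
    rw [e, hS] at h0
    linarith
  rw [isSolution_iff hp]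
  refine fun w => Complex.ext (hre w) ?_
  -- Real parts are known for every direction; the direction `i w` supplies the imaginary part.
  have h := hre (Complex.I • w)
  rw [energyForm_smul_left] at h
  have e : (Complex.I • w).fn = Complex.I • w.fn := rfl
  rw [e, inner_smul_left] at h
  simpa using h

/-! ### Ground states -/

theorem action_eq_of_isSolution (hp : 2 < p) {W : H12} (h : IsSolution p W) :
    action p W = (1 / 2 - 1 / p) * W.normPow p := by
  have h1 := h.energy_eq_normPow hp
  unfold energy at h1
  unfold action
  rw [sub_mul, ← h1]
  ring

/-- With `N = normPow = energy`, the variational inequality reads `S N^{2/p} ≤ N`. -/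
theorem minEnergy_rpow_le (hp : 2 < p) {V : H12} (hV : V ≠ 0) (h : IsSolution p V) :
    minEnergy p ^ (p / (p - 2)) ≤ V.normPow p := by
  have hp0 : 0 < p := by linarith
  have hp2 : 0 < p - 2 := by linarith
  have hP := normPow_pos hp hV
  have h1 := minEnergy_mul_le hp V
  rw [h.energy_eq_normPow hp] at h1
  have h2 : minEnergy p ≤ V.normPow p ^ ((p - 2) / p) := by
    rw [show (p - 2) / p = 1 - 2 / p by field_simp, Real.rpow_sub hP, Real.rpow_one,
      le_div_iff₀ (by positivity)]
    exact h1
  calc minEnergy p ^ (p / (p - 2)) ≤ (V.normPow p ^ ((p - 2) / p)) ^ (p / (p - 2)) :=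
        Real.rpow_le_rpow (minEnergy_pos hp).le h2 (by positivity)
    _ = V.normPow p := by
        rw [← Real.rpow_mul hP.le, show (p - 2) / p * (p / (p - 2)) = 1 by field_simp,
          Real.rpow_one]

theorem exists_solution_normPow_eq (hp : 2 < p) :
    ∃ W : H12, W ≠ 0 ∧ IsSolution p W ∧ W.normPow p = minEnergy p ^ (p / (p - 2)) := by
  obtain ⟨v, hv1, hvS⟩ := exists_minimizer hp
  have hp0 : 0 < p := by linarith
  have hp2 : 0 < p - 2 := by linarith
  have hS := minEnergy_pos hp
  -- The multiple for which `energy = c² S` and `normPow = c^p` agree.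
  set c : ℝ := minEnergy p ^ (1 / (p - 2))
  have hc : 0 < c := by positivity
  have hcn : ‖(c : ℂ)‖ = c := by rw [Complex.norm_real, Real.norm_of_nonneg hc.le]
  have hP : ((c : ℂ) • v).normPow p = c ^ p := by rw [normPow_smul, hcn, hv1, mul_one]
  have hE : ((c : ℂ) • v).energy = c ^ 2 * minEnergy p := by rw [energy_smul, hcn, hvS]
  have hcp : c ^ (p - 2) = minEnergy p := by
    rw [← Real.rpow_mul hS.le, one_div_mul_cancel hp2.ne', Real.rpow_one]
  have hv0 : (c : ℂ) • v ≠ 0 := fun h => by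
    rw [h, (normPow_eq_zero_iff hp).2 rfl] at hP
    have : 0 < c ^ p := by positivity
    linarith
  refine ⟨(c : ℂ) • v, hv0, isSolution_of_minimizer hp hv0 ?_ ?_, ?_⟩
  · rw [hE, hP, ← Real.rpow_mul hc.le, mul_div_cancel₀ _ hp0.ne', Real.rpow_two, mul_comm]
  · rw [hE, hP, ← hcp, ← Real.rpow_two, ← Real.rpow_add hc]
    congr 1
    ring
  · rw [hP, ← Real.rpow_mul hS.le]
    congr 1
    field_simp

/-- On solutions the action is `(1/2 - 1/p) normPow` with a positive factor, and the lower bound for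
`normPow` is attained. -/
theorem isGroundState_iff (hp : 2 < p) {W : H12} : IsGroundState p W ↔
    W ≠ 0 ∧ IsSolution p W ∧ W.normPow p = minEnergy p ^ (p / (p - 2)) := by
  have hc : 0 < 1 / 2 - 1 / p := by
    rw [sub_pos]
    exact one_div_lt_one_div_of_lt (by norm_num) hp
  constructor
  · rintro ⟨h0, hs, hmin⟩
    obtain ⟨V, hV0, hVs, hV⟩ := exists_solution_normPow_eq hp
    have h := hmin V hV0 hVs
    rw [action_eq_of_isSolution hp hs, action_eq_of_isSolution hp hVs, hV] at h
    exact ⟨h0, hs, le_antisymm (le_of_mul_le_mul_left h hc) (minEnergy_rpow_le hp h0 hs)⟩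
  · rintro ⟨h0, hs, hP⟩
    refine ⟨h0, hs, fun V hV0 hVs => ?_⟩
    rw [action_eq_of_isSolution hp hs, action_eq_of_isSolution hp hVs, hP]
    exact mul_le_mul_of_nonneg_left (minEnergy_rpow_le hp hV0 hVs) hc.le

theorem IsGroundState.energy_eq (hp : 2 < p) {W : H12} (h : IsGroundState p W) :
    W.energy = minEnergy p * W.normPow p ^ (2 / p) := by
  obtain ⟨-, hs, hP⟩ := (isGroundState_iff hp).1 h
  have hS := minEnergy_pos hp
  have hp0 : p ≠ 0 := by linarith
  have hp2 : p - 2 ≠ 0 := by linarith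
  rw [hs.energy_eq_normPow hp, hP, ← Real.rpow_mul hS.le]
  nth_rewrite 2 [← Real.rpow_one (minEnergy p)]
  rw [← Real.rpow_add hS]
  congr 1
  field_simp
  ring

end H12

namespace H12

variable {p : ℝ}

/-! ### The optimal constant -/

/-- The geometric mean of `‖∂ₓu‖₂²`, `‖∂_{yy}u‖₂²` and `‖u‖₂²` that corresponds to `energy`. -/
noncomputable def geomEnergy (p : ℝ) (u : H12) : ℝ :=
  (‖u.dx‖ ^ 2 / ((p - 2) / (2 * p))) ^ ((p - 2) / (2 * p)) *
    (‖u.dyy‖ ^ 2 / ((p - 2) / (4 * p))) ^ ((p - 2) / (4 * p)) *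
    (‖u.fn‖ ^ 2 / ((p + 6) / (4 * p))) ^ ((p + 6) / (4 * p))

/-- The factor between `geomEnergy` and `gnProduct^{2/p}`. -/
noncomputable def geomFactor (p : ℝ) : ℝ :=
  (((p - 2) / (2 * p)) ^ ((p - 2) / (2 * p)) * ((p - 2) / (4 * p)) ^ ((p - 2) / (4 * p)) *
    ((p + 6) / (4 * p)) ^ ((p + 6) / (4 * p)))⁻¹

theorem geomFactor_pos (hp : 2 < p) : 0 < geomFactor p := by
  have hp0 : 0 < p := by linarith
  have hp2 : 0 < p - 2 := by linarith
  unfold geomFactor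
  positivity

/-- Each AM–GM weight is the matching exponent of `gnProduct` divided by `p`. -/
theorem geomEnergy_eq (hp : 2 < p) (u : H12) :
    geomEnergy p u = geomFactor p * u.gnProduct p ^ (2 / p) := by
  have hp0 : 0 < p := by linarith
  have hp2 : 0 < p - 2 := by linarith
  have key : ∀ {x θ k : ℝ}, 0 ≤ x → 0 < θ → 2 * θ = k * (2 / p) →
      (x ^ 2 / θ) ^ θ = (θ ^ θ)⁻¹ * (x ^ k) ^ (2 / p) := fun {x θ k} hx hθ hk => by
    rw [Real.div_rpow (by positivity) hθ.le, ← Real.rpow_mul hx, ← hk, Real.rpow_mul hx,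
      Real.rpow_two, div_eq_inv_mul]
  rw [geomEnergy, gnProduct, Real.mul_rpow (by positivity) (by positivity),
    Real.mul_rpow (by positivity) (by positivity),
    key (k := (p - 2) / 2) (norm_nonneg u.dx) (by positivity) (by field_simp),
    key (k := (p - 2) / 4) (norm_nonneg u.dyy) (by positivity) (by field_simp),
    key (k := (p + 6) / 4) (norm_nonneg u.fn) (by positivity) (by field_simp), geomFactor,
    mul_inv, mul_inv]
  ring

theorem weights_sum (hp : 2 < p) :
    (p - 2) / (2 * p) + (p - 2) / (4 * p) + (p + 6) / (4 * p) = 1 := by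
  have hp0 : p ≠ 0 := by linarith
  field_simp
  ring

theorem geomEnergy_le_energy (hp : 2 < p) (u : H12) : geomEnergy p u ≤ u.energy := by
  have hp0 : 0 < p := by linarith
  have hp2 : 0 < p - 2 := by linarith
  have h := Real.geom_mean_le_arith_mean3_weighted (w₁ := (p - 2) / (2 * p))
    (w₂ := (p - 2) / (4 * p)) (w₃ := (p + 6) / (4 * p))
    (p₁ := ‖u.dx‖ ^ 2 / ((p - 2) / (2 * p))) (p₂ := ‖u.dyy‖ ^ 2 / ((p - 2) / (4 * p)))
    (p₃ := ‖u.fn‖ ^ 2 / ((p + 6) / (4 * p))) (by positivity) (by positivity) (by positivity)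
    (by positivity) (by positivity) (by positivity) (weights_sum hp)
  rwa [mul_div_cancel₀ _ (by positivity), mul_div_cancel₀ _ (by positivity),
    mul_div_cancel₀ _ (by positivity)] at h

/-- The equality case of `geomEnergy_le_energy`. -/
theorem eq_of_geomEnergy_eq_energy (hp : 2 < p) {u : H12} (h : geomEnergy p u = u.energy) :
    ‖u.dx‖ ^ 2 = (p - 2) / (2 * p) * u.energy ∧ ‖u.dyy‖ ^ 2 = (p - 2) / (4 * p) * u.energy ∧
      ‖u.fn‖ ^ 2 = (p + 6) / (4 * p) * u.energy := by
  have hp0 : 0 < p := by linarith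
  have hp2 : 0 < p - 2 := by linarith
  have h1 : 0 < (p - 2) / (2 * p) := by positivity
  have h2 : 0 < (p - 2) / (4 * p) := by positivity
  have h3 : 0 < (p + 6) / (4 * p) := by positivity
  have hsum := weights_sum hp
  unfold geomEnergy energy at h
  unfold energy
  generalize (p - 2) / (2 * p) = a at *
  generalize (p - 2) / (4 * p) = b at *
  generalize (p + 6) / (4 * p) = c at *
  have hiff := Real.geom_mean_eq_arith_mean_weighted_iff_of_pos' (Finset.univ : Finset (Fin 3))
    ![a, b, c] ![‖u.dx‖ ^ 2 / a, ‖u.dyy‖ ^ 2 / b, ‖u.fn‖ ^ 2 / c]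
    (by intro i _; fin_cases i <;> simpa) (by simpa [Fin.sum_univ_three] using hsum)
    (by intro i _; fin_cases i <;> simp <;> positivity)
  simp only [Fin.prod_univ_three, Fin.sum_univ_three, Matrix.cons_val_zero, Matrix.cons_val_one,
    Matrix.cons_val, mul_div_cancel₀ _ h1.ne', mul_div_cancel₀ _ h2.ne',
    mul_div_cancel₀ _ h3.ne'] at hiff
  have hall := hiff.1 h
  have e1 := hall 0 (Finset.mem_univ _)
  have e2 := hall 1 (Finset.mem_univ _)
  have e3 := hall 2 (Finset.mem_univ _)
  simp only [Matrix.cons_val_zero, Matrix.cons_val_one, Matrix.cons_val,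
    div_eq_iff h1.ne', div_eq_iff h2.ne', div_eq_iff h3.ne'] at e1 e2 e3
  exact ⟨e1.trans (mul_comm _ _), e2.trans (mul_comm _ _), e3.trans (mul_comm _ _)⟩

theorem norms_pos (hp : 2 < p) {u : H12} (hu : u ≠ 0) : 0 < ‖u.dx‖ ∧ 0 < ‖u.dyy‖ ∧ 0 < ‖u.fn‖ := by
  have h := (gnProduct_pos hp hu).ne'
  unfold gnProduct at h
  refine ⟨(norm_nonneg _).lt_of_ne' fun h0 => h ?_, (norm_nonneg _).lt_of_ne' fun h0 => h ?_,
    (norm_nonneg _).lt_of_ne' fun h0 => h ?_⟩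
  · rw [h0, Real.zero_rpow (by linarith), zero_mul, zero_mul]
  · rw [h0, Real.zero_rpow (by linarith), mul_zero, zero_mul]
  · rw [h0, Real.zero_rpow (by linarith), mul_zero]

/-- The factor is that of `normPow^{2/p}`, so their quotient is invariant under both dilations. -/
theorem geomEnergy_rescale (hp : 2 < p) {l m : ℝ} (hl : 0 < l) (hm : 0 < m) (a : Plane) (u : H12) :
    geomEnergy p (rescale hl hm a u) = ((l * m)⁻¹) ^ (2 / p) * geomEnergy p u := by
  have hp0 : 0 < p := by linarith
  have hp2 : 0 < p - 2 := by linarith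
  have key : ∀ {k x θ : ℝ}, 0 ≤ k → 0 ≤ x → 0 < θ →
      (k * x / θ) ^ θ = k ^ θ * (x / θ) ^ θ := fun hk hx hθ => by
    rw [mul_div_assoc, Real.mul_rpow hk (by positivity)]
  have hfac : (l / m) ^ ((p - 2) / (2 * p)) * (m ^ 3 / l) ^ ((p - 2) / (4 * p)) *
      ((l * m)⁻¹) ^ ((p + 6) / (4 * p)) = ((l * m)⁻¹) ^ (2 / p) := by
    have e1 : l / m = Real.exp (Real.log l - Real.log m) := by
      rw [Real.exp_sub, Real.exp_log hl, Real.exp_log hm]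
    have e2 : m ^ 3 / l = Real.exp (3 * Real.log m - Real.log l) := by
      rw [Real.exp_sub, Real.exp_log hl, mul_comm, Real.exp_mul, Real.exp_log hm]
      norm_cast
    have e3 : (l * m)⁻¹ = Real.exp (-(Real.log l + Real.log m)) := by
      rw [Real.exp_neg, Real.exp_add, Real.exp_log hl, Real.exp_log hm]
    rw [e1, e2, e3, ← Real.exp_mul, ← Real.exp_mul, ← Real.exp_mul, ← Real.exp_mul, ← Real.exp_add,
      ← Real.exp_add]
    congr 1
    field_simp
    ring
  rw [geomEnergy, norm_sq_dx_rescale, norm_sq_dyy_rescale, norm_sq_fn_rescale,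
    key (by positivity) (by positivity) (by positivity),
    key (by positivity) (by positivity) (by positivity),
    key (by positivity) (by positivity) (by positivity), ← hfac, geomEnergy]
  ring

/-- Every nonzero function can be rescaled to one for which the means agree. -/
theorem exists_rescale_geomEnergy_eq (hp : 2 < p) {u : H12} (hu : u ≠ 0) :
    ∃ (l m : ℝ) (hl : 0 < l) (hm : 0 < m),
      geomEnergy p (rescale hl hm 0 u) = (rescale hl hm 0 u).energy := by
  obtain ⟨hA, hB, hM⟩ := norms_pos hp hu
  have hp0 : 0 < p := by linarith
  have hp2 : 0 < p - 2 := by linarith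
  have h1 : 0 < (p - 2) / (2 * p) := by positivity
  have h2 : 0 < (p - 2) / (4 * p) := by positivity
  have h3 : 0 < (p + 6) / (4 * p) := by positivity
  have hsum := weights_sum hp
  -- Equality in AM–GM needs the three ratios of squared norm to weight to coincide after rescaling,
  -- that is, `l² = r` and `m⁴ = q`. Their common value is `t` below.
  set r : ℝ := ‖u.fn‖ ^ 2 * ((p - 2) / (2 * p)) / (‖u.dx‖ ^ 2 * ((p + 6) / (4 * p))) with hr
  set q : ℝ := ‖u.fn‖ ^ 2 * ((p - 2) / (4 * p)) / (‖u.dyy‖ ^ 2 * ((p + 6) / (4 * p))) with hq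
  have hr0 : 0 < r := by positivity
  have hq0 : 0 < q := by positivity
  have hl : 0 < √r := Real.sqrt_pos.2 hr0
  have hm : 0 < √(√q) := Real.sqrt_pos.2 (Real.sqrt_pos.2 hq0)
  have hl2 : √r ^ 2 = r := Real.sq_sqrt hr0.le
  have hm4 : √(√q) ^ 4 = q := by
    rw [show √(√q) ^ 4 = (√(√q) ^ 2) ^ 2 by ring, Real.sq_sqrt (Real.sqrt_nonneg q),
      Real.sq_sqrt hq0.le]
  refine ⟨√r, √(√q), hl, hm, ?_⟩
  set t : ℝ := (√r * √(√q))⁻¹ * ‖u.fn‖ ^ 2 / ((p + 6) / (4 * p)) with ht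
  have ht0 : 0 < t := by positivity
  have hfn : ‖(rescale hl hm 0 u).fn‖ ^ 2 = (p + 6) / (4 * p) * t := by
    rw [norm_sq_fn_rescale, ht, mul_div_cancel₀ _ h3.ne']
  have hdx : ‖(rescale hl hm 0 u).dx‖ ^ 2 = (p - 2) / (2 * p) * t := by
    rw [norm_sq_dx_rescale, ht]
    have e : √r / √(√q) = √r ^ 2 * (√r * √(√q))⁻¹ := by field_simp
    rw [e, hl2, hr]
    field_simp
  have hdyy : ‖(rescale hl hm 0 u).dyy‖ ^ 2 = (p - 2) / (4 * p) * t := by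
    rw [norm_sq_dyy_rescale, ht]
    have e : √(√q) ^ 3 / √r = √(√q) ^ 4 * (√r * √(√q))⁻¹ := by field_simp
    rw [e, hm4, hq]
    field_simp
  rw [geomEnergy, energy, hfn, hdx, hdyy, mul_div_cancel_left₀ _ h1.ne',
    mul_div_cancel_left₀ _ h2.ne', mul_div_cancel_left₀ _ h3.ne', ← Real.rpow_add ht0,
    ← Real.rpow_add ht0, ← add_mul, ← add_mul, hsum, Real.rpow_one, one_mul]

theorem minEnergy_mul_le_geomEnergy (hp : 2 < p) (u : H12) :
    minEnergy p * u.normPow p ^ (2 / p) ≤ geomEnergy p u := by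
  have hp0 : 0 < p := by linarith
  by_cases hu : u = 0
  · rw [(normPow_eq_zero_iff hp).2 hu, Real.zero_rpow (by positivity), mul_zero,
      geomEnergy_eq hp]
    exact mul_nonneg (geomFactor_pos hp).le (Real.rpow_nonneg (gnProduct_nonneg p u) _)
  · obtain ⟨l, m, hl, hm, h⟩ := exists_rescale_geomEnergy_eq hp hu
    have h1 := minEnergy_mul_le hp (rescale hl hm 0 u)
    rw [← h, geomEnergy_rescale hp, normPow_rescale,
      Real.mul_rpow (by positivity) (normPow_nonneg p u), mul_left_comm] at h1
    exact le_of_mul_le_mul_left h1 (by positivity)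

/-- The optimal constant in the Gagliardo–Nirenberg inequality. -/
noncomputable def optConst (p : ℝ) : ℝ := (geomFactor p / minEnergy p) ^ (p / 2)

theorem optConst_pos (hp : 2 < p) : 0 < optConst p :=
  Real.rpow_pos_of_pos (div_pos (geomFactor_pos hp) (minEnergy_pos hp)) _

theorem optConst_mul_gnProduct (hp : 2 < p) (u : H12) :
    optConst p * u.gnProduct p = (geomEnergy p u / minEnergy p) ^ (p / 2) := by
  have hp0 : p ≠ 0 := by linarith
  have hG := gnProduct_nonneg p u
  rw [geomEnergy_eq hp, mul_div_right_comm, Real.mul_rpow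
    (div_pos (geomFactor_pos hp) (minEnergy_pos hp)).le (by positivity), ← Real.rpow_mul hG,
    show 2 / p * (p / 2) = 1 by field_simp, Real.rpow_one, optConst]

theorem normPow_le_optConst_mul (hp : 2 < p) (u : H12) :
    u.normPow p ≤ optConst p * u.gnProduct p := by
  have hp0 : p ≠ 0 := by linarith
  have hP := normPow_nonneg p u
  rw [optConst_mul_gnProduct hp]
  calc u.normPow p = (u.normPow p ^ (2 / p)) ^ (p / 2) := by
        rw [← Real.rpow_mul hP, show 2 / p * (p / 2) = 1 by field_simp, Real.rpow_one]
    _ ≤ _ := by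
        refine Real.rpow_le_rpow (by positivity) ?_ (by linarith)
        rw [le_div_iff₀' (minEnergy_pos hp)]
        exact minEnergy_mul_le_geomEnergy hp u

/-- A minimiser closes the chain `S · normPow^{2/p} ≤ geomEnergy ≤ energy`, so it is an equality
case of AM–GM. -/
theorem geomEnergy_eq_of_minimizer (hp : 2 < p) {u : H12}
    (hmin : u.energy = minEnergy p * u.normPow p ^ (2 / p)) : geomEnergy p u = u.energy :=
  (geomEnergy_le_energy hp u).antisymm (hmin.trans_le (minEnergy_mul_le_geomEnergy hp u))

theorem normPow_eq_optConst_mul (hp : 2 < p) {u : H12}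
    (hmin : u.energy = minEnergy p * u.normPow p ^ (2 / p)) :
    u.normPow p = optConst p * u.gnProduct p := by
  have hp0 : p ≠ 0 := by linarith
  rw [optConst_mul_gnProduct hp, geomEnergy_eq_of_minimizer hp hmin, hmin,
    mul_div_cancel_left₀ _ (minEnergy_pos hp).ne', ← Real.rpow_mul (normPow_nonneg p u),
    show 2 / p * (p / 2) = 1 by field_simp, Real.rpow_one]

/-- Equality in AM–GM expresses `‖∂ₓW‖₂`, `‖∂_{yy}W‖₂` and `energy = normPow` through `‖W‖₂` alone;
the constant is `normPow / gnProduct`. -/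
theorem IsGroundState.optConst_eq (hp : 2 < p) {W : H12} (hW : IsGroundState p W) :
    optConst p = p * (p + 6) ^ (3 * (p - 2) / 8 - 1) /
      (2 ^ ((p - 2) / 4 - 2) * (p - 2) ^ (3 * (p - 2) / 8) * ‖W.fn‖ ^ (p - 2)) := by
  have hp0 : 0 < p := by linarith
  have hp2 : 0 < p - 2 := by linarith
  have hp6 : 0 < p + 6 := by linarith
  have hmin := hW.energy_eq hp
  have hEP := hW.2.1.energy_eq_normPow hp
  obtain ⟨hdx, hdyy, hfn⟩ := eq_of_geomEnergy_eq_energy hp (geomEnergy_eq_of_minimizer hp hmin)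
  have hGP := normPow_eq_optConst_mul hp hmin
  obtain ⟨-, -, hn⟩ := norms_pos hp hW.1
  set n := ‖W.fn‖
  have hE : W.energy = 4 * p / (p + 6) * n ^ 2 := by
    rw [hfn]
    field_simp
  have hrt : ∀ {x c : ℝ}, 0 ≤ x → 0 ≤ c → x ^ 2 = c * n ^ 2 → x = c ^ (1 / 2 : ℝ) * n := by
    intro x c hx hc h
    rw [← Real.sqrt_eq_rpow, ← Real.sqrt_sq hx, h, Real.sqrt_mul hc, Real.sqrt_sq hn.le]
  have hx : ‖W.dx‖ = (2 * ((p - 2) / (p + 6))) ^ (1 / 2 : ℝ) * n := by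
    refine hrt (norm_nonneg _) (by positivity) ?_
    rw [hdx, hE]
    field_simp
    norm_num
  have hy : ‖W.dyy‖ = ((p - 2) / (p + 6)) ^ (1 / 2 : ℝ) * n := by
    refine hrt (norm_nonneg _) (by positivity) ?_
    rw [hdyy, hE]
    field_simp
  rw [← hEP, hE, gnProduct, hx, hy] at hGP
  have hG : 0 < ((2 * ((p - 2) / (p + 6))) ^ (1 / 2 : ℝ) * n) ^ ((p - 2) / 2) *
      (((p - 2) / (p + 6)) ^ (1 / 2 : ℝ) * n) ^ ((p - 2) / 4) * n ^ ((p + 6) / 4) := by positivity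
  rw [← (div_eq_iff hG.ne').2 hGP, div_eq_div_iff hG.ne' (by positivity)]
  -- All positive factors except `p` become exponentials of logarithms, which reduces the claim to a
  -- linear identity between exponents.
  have l2 : (4 : ℝ) = Real.exp (2 * Real.log 2) := by
    rw [mul_comm, Real.exp_mul, Real.exp_log two_pos]; norm_num
  have l3 : (p - 2) / (p + 6) = Real.exp (Real.log (p - 2) - Real.log (p + 6)) := by
    rw [Real.exp_sub, Real.exp_log hp2, Real.exp_log hp6]
  have l4 : 4 * p / (p + 6) = p * Real.exp (2 * Real.log 2 - Real.log (p + 6)) := by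
    rw [Real.exp_sub, Real.exp_log hp6, ← l2]
    ring
  have l5 : 2 * ((p - 2) / (p + 6)) =
      Real.exp (Real.log 2 + (Real.log (p - 2) - Real.log (p + 6))) := by
    rw [Real.exp_add, Real.exp_log two_pos, l3]
  have l6 : n ^ 2 = Real.exp (Real.log n * 2) := by
    rw [Real.exp_mul, Real.exp_log hn, Real.rpow_two]
  have l7 : ∀ {x : ℝ} (y : ℝ), 0 < x → x ^ y = Real.exp (Real.log x * y) := fun y hx =>
    Real.rpow_def_of_pos hx y
  have l8 : ∀ {s : ℝ}, Real.exp s * n = Real.exp (s + Real.log n) := fun {s} => by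
    rw [Real.exp_add, Real.exp_log hn]
  rw [l4, l5, l6, l3, l7 _ hp6, l7 _ two_pos, l7 _ hp2, l7 _ hn, l7 _ hn, ← Real.exp_mul,
    ← Real.exp_mul, l8, l8, ← Real.exp_mul, ← Real.exp_mul, mul_assoc p, mul_assoc p, mul_assoc p]
  congr 1
  simp only [← Real.exp_add]
  congr 1
  ring

end H12

theorem lemma2p2 (p : ℝ) (hp : 2 < p) :
    (∀ u : H12, MemLp (u.fn : Plane → ℂ) (ENNReal.ofReal p) volume) ∧
    ∃ Copt : ℝ, 0 < Copt ∧
      IsLeast {C : ℝ | ∀ u : H12, u.normPow p ≤ C * u.gnProduct p} Copt ∧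
      (∃ u : H12, u ≠ 0 ∧ u.normPow p = Copt * u.gnProduct p) ∧
      (∃ W : H12, W.IsGroundState p) ∧
      ∀ W : H12, W.IsGroundState p →
        Copt = p * (p + 6) ^ (3 * (p - 2) / 8 - 1) /
          (2 ^ ((p - 2) / 4 - 2) * (p - 2) ^ (3 * (p - 2) / 8) * ‖W.fn‖ ^ (p - 2)) := by
  obtain ⟨W, hW⟩ := H12.exists_solution_normPow_eq hp
  have hG : W.IsGroundState p := (H12.isGroundState_iff hp).2 hW
  have hEq := H12.normPow_eq_optConst_mul hp (hG.energy_eq hp)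
  refine ⟨H12.memLp_fn hp, H12.optConst p, H12.optConst_pos hp,
    ⟨H12.normPow_le_optConst_mul hp, fun C hC => ?_⟩, ⟨W, hG.1, hEq⟩, ⟨W, hG⟩,
    fun V hV => hV.optConst_eq hp⟩
  -- Equality at `W` with `gnProduct` positive forces every admissible constant to be at least
  -- `optConst`.
  exact le_of_mul_le_mul_right (hEq.symm.trans_le (hC W)) (H12.gnProduct_pos hp hG.1)
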